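/- Let $\Bbbk$ be a field and let $C$ be a (coassociative, counital) coalgebra over $\Bbbk$, with no finiteness assumption. Let $\mathfrak{M}^C$ be the $\Bbbk$-linear category of right $C$-comodules and $\mathfrak{M}^C_{\mathrm{fd}}$ its full subcategory of finite-dimensional comodules; write $\mathrm{Hom}^C$ for the Hom spaces of $\mathfrak{M}^C$. The dual space $C^*$ is an algebra under $\langle f*g,c\rangle=\langle f,c_{(1)}\rangle\langle g,c_{(2)}\rangle$; a right $C$-comodule $M$ is a left $C^*$-module by $f\rightharpoonup m=m_{(0)}\langle f,m_{(1)}\rangle$, and $C$ is a right $C^*$-module by $c\leftharpoonup f=\langle f,c_{(1)}\rangle c_{(2)}$. For a left $C^*$-module $N$, let $N^{\mathrm{rat}}$ be its largest rational submodule, i.e. the set of all $n\in N$ for which there is $\sum_i n_i\otimes c_i\in N\otimes_\Bbbk C$ with $f\cdot n=\sum_i\langle f,c_i\rangle n_i$ for all $f\in C^*$; it is a right $C$-comodule by $n\mapsto\sum_i n_i\otimes c_i$. For $M\in\mathfrak{M}^C$ put $$\mathbb{N}^{\mathrm{l}}_C(M)=\mathrm{Hom}^C(C,M)^{\mathrm{rat}},\qquad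 \mathbb{N}^{\mathrm{r}}_C(M)=C\otimes_{C^*}M,$$ where $\mathrm{Hom}^C(C,M)$ is a left $C^*$-module by $(f\cdot\xi)(c)=\langle f,c_{(1)}\rangle\xi(c_{(2)})$, and $C\otimes_{C^*}M$ is a right $C$-comodule by $c\otimes m\mapsto(c_{(1)}\otimes m)\otimes c_{(2)}$. These are endofunctors of $\mathfrak{M}^C$, the left exact and the right exact Nakayama functor. For a vector space $W$ and $X\in\mathfrak{M}^C$, the space $W\otimes_\Bbbk X$ is a comodule with coaction $\mathrm{id}_W\otimes\delta_X$. For $X\in\mathfrak{M}^C_{\mathrm{fd}}$ and $M\in\mathfrak{M}^C$, let $\mathrm{coHom}^C(X,M)$ be the vector space representing the functor $W\mapsto\mathrm{Hom}^C(M,W\otimes_\Bbbk X)$ (it exists), which is contravariantly functorial in $X$. **Theorem.** 1. For every $M\in\mathfrak{M}^C$, the comodule $\mathbb{N}^{\mathrm{l}}_C(M)$ is an end of the functor $$(\mathfrak{M}^C_{\mathrm{fd}})^{\mathrm{op}}\times\mathfrak{M}^C_{\mathrm{fd}}\to\mathfrak{M}^C,\qquad (X,Y)\mapsto\mathrm{Hom}^C(X,M)\otimes_\Bbbk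 Y,$$ and the comodule $\mathbb{N}^{\mathrm{r}}_C(M)$ is a coend of the functor $$(\mathfrak{M}^C_{\mathrm{fd}})^{\mathrm{op}}\times\mathfrak{M}^C_{\mathrm{fd}}\to\mathfrak{M}^C,\qquad (X,Y)\mapsto\mathrm{coHom}^C(X,M)\otimes_\Bbbk Y,$$ where the end and the coend are taken in $\mathfrak{M}^C$. 2. If $D$ is another coalgebra over $\Bbbk$ and $\Phi:\mathfrak{M}^C\to\mathfrak{M}^D$ is an equivalence of $\Bbbk$-linear categories, then there are isomorphisms of functors $$\Phi\circ\mathbb{N}^{\mathrm{l}}_C\cong\mathbb{N}^{\mathrm{l}}_D\circ\Phi,\qquad \Phi\circ\mathbb{N}^{\mathrm{r}}_C\cong\mathbb{N}^{\mathrm{r}}_D\circ\Phi.$$ -/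

import Mathlib

open CategoryTheory Limits Opposite TensorProduct

universe u

namespace Nakayama

noncomputable section

section Slices

variable {k : Type u} [Field k] {C : Type u} [AddCommGroup C] [Module k C]

/-- The map `id ⊗ f : N ⊗ C → N ⊗ k = N`, i.e. `n ⊗ c ↦ f(c) n`. -/
def slice (N : Type u) [AddCommGroup N] [Module k N] (f : C →ₗ[k] k) : N ⊗[k] C →ₗ[k] N :=
  (TensorProduct.rid k N).toLinearMap ∘ₗ f.lTensor N

variable {N N' : Type u} [AddCommGroup N] [Module k N] [AddCommGroup N'] [Module k N']

@[simp]
lemma slice_tmul (f : C →ₗ[k] k) (n : N) (c : C) : slice N f (n ⊗ₜ c) = f c • n := by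
  simp [slice]

/-- Functionals on `C` separate the elements of `N ⊗ C`. -/
lemma slice_ext {t t' : N ⊗[k] C} (h : ∀ f : C →ₗ[k] k, slice N f t = slice N f t') :
    t = t' := by
  let b := Module.Basis.ofVectorSpace k C
  classical
  apply (TensorProduct.equivFinsuppOfBasisRight (M := N) b).injective
  ext i
  have key : ∀ s : N ⊗[k] C,
      TensorProduct.equivFinsuppOfBasisRight (M := N) b s i = slice N (b.coord i) s := by
    intro s
    induction s with
    | zero => simp
    | add x y hx hy => simp [hx, hy]
    | tmul n c => simp
  rw [key, key, h]

lemma slice_rTensor (g : N →ₗ[k] N') (f : C →ₗ[k] k) (t : N ⊗[k] C) :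
    slice N' f (g.rTensor C t) = g (slice N f t) := by
  induction t with
  | zero => simp
  | add x y hx hy => simp [hx, hy]
  | tmul n c => simp

lemma exists_of_slice_mem (S : Submodule k N) (t : N ⊗[k] C)
    (h : ∀ f : C →ₗ[k] k, slice N f t ∈ S) : ∃ s : S ⊗[k] C, S.subtype.rTensor C s = t := by
  let b := Module.Basis.ofVectorSpace k C
  obtain ⟨c, rfl⟩ := TensorProduct.eq_repr_basis_right b t
  have hc : ∀ i, c i ∈ S := by
    intro i
    classical
    have := h (b.coord i)
    rw [Finsupp.sum, map_sum, Finset.sum_eq_single i] at this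
    · simpa using this
    · intro j _ hj
      simp [hj]
    · intro hi
      simp [Finsupp.notMem_support_iff.mp hi]
  refine ⟨c.sum fun i n => (⟨c i, hc i⟩ : S) ⊗ₜ b i, ?_⟩
  simp [Finsupp.sum]

variable [Coalgebra k C]

lemma slice_slice_comul (f g : C →ₗ[k] k) (t : N ⊗[k] C) :
    slice N f (slice (N ⊗[k] C) g ((TensorProduct.assoc k N C C).symm
      ((Coalgebra.comul (R := k)).lTensor N t))) =
    slice N (WithConv.toConv f * WithConv.toConv g).ofConv t := by
  induction t with
  | zero => simp
  | add x y hx hy => simp only [map_add, hx, hy]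
  | tmul n c =>
    simp only [LinearMap.lTensor_tmul, slice_tmul]
    rw [LinearMap.convMul_def]
    simp only [LinearMap.comp_apply]
    generalize Coalgebra.comul (R := k) c = s
    induction s with
    | zero => simp
    | add x y hx hy => simp only [map_add, tmul_add, hx, hy, add_smul]
    | tmul a b => simp [mul_smul, smul_comm (f a) (g b)]

end Slices

section BalancedTensor

variable {k : Type u} [Field k] {C : Type u} [AddCommGroup C] [Module k C]

/-- For a right action `ra` on `P` and a left action `la` on `N` of `C*`, the submodule of `P ⊗ N`
spanned by the elements `(p · f) ⊗ n - p ⊗ (f · n)`. -/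
def balancedRel {P N : Type u} [AddCommGroup P] [Module k P] [AddCommGroup N] [Module k N]
    (ra : (C →ₗ[k] k) → P →ₗ[k] P) (la : (C →ₗ[k] k) → N →ₗ[k] N) : Submodule k (P ⊗[k] N) :=
  Submodule.span k {t | ∃ f p n, t = ra f p ⊗ₜ n - p ⊗ₜ la f n}

/-- The tensor product `P ⊗_{C*} N` over `C*`. -/
abbrev BalancedTensor {P N : Type u} [AddCommGroup P] [Module k P] [AddCommGroup N] [Module k N]
    (ra : (C →ₗ[k] k) → P →ₗ[k] P) (la : (C →ₗ[k] k) → N →ₗ[k] N) : Type u :=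
  (P ⊗[k] N) ⧸ balancedRel ra la

section Balanced

variable {P N : Type u} [AddCommGroup P] [Module k P] [AddCommGroup N] [Module k N]
    (ra : (C →ₗ[k] k) → P →ₗ[k] P) (la : (C →ₗ[k] k) → N →ₗ[k] N)

lemma mk_balanced (f : C →ₗ[k] k) (p : P) (n : N) :
    (balancedRel ra la).mkQ (ra f p ⊗ₜ n) = (balancedRel ra la).mkQ (p ⊗ₜ la f n) := by
  rw [← sub_eq_zero, ← map_sub, Submodule.mkQ_apply, Submodule.Quotient.mk_eq_zero]
  exact Submodule.subset_span ⟨f, p, n, rfl⟩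

variable {ra la}

lemma balancedRel_le_ker {W : Type u} [AddCommGroup W] [Module k W] (φ : P ⊗[k] N →ₗ[k] W)
    (h : ∀ f p n, φ (ra f p ⊗ₜ n) = φ (p ⊗ₜ la f n)) : balancedRel ra la ≤ LinearMap.ker φ := by
  rw [balancedRel, Submodule.span_le]
  rintro _ ⟨f, p, n, rfl⟩
  rw [SetLike.mem_coe, LinearMap.mem_ker, map_sub, h, sub_self]

lemma balanced_induction {P N : Type u} [AddCommGroup P] [Module k P] [AddCommGroup N] [Module k N]
    {ra : (C →ₗ[k] k) → P →ₗ[k] P} {la : (C →ₗ[k] k) → N →ₗ[k] N} {W : Type u} [AddCommGroup W]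
    [Module k W] {φ ψ : BalancedTensor ra la →ₗ[k] W}
    (h : ∀ p n, φ ((balancedRel ra la).mkQ (p ⊗ₜ n)) = ψ ((balancedRel ra la).mkQ (p ⊗ₜ n))) :
    φ = ψ := by
  apply Submodule.linearMap_qext
  ext p n
  exact h p n

lemma exists_universal_balanced (ra : (C →ₗ[k] k) → P →ₗ[k] P) (la : (C →ₗ[k] k) → N →ₗ[k] N) :
    ∃ (Q : ModuleCat.{u} k) (q : P →ₗ[k] N →ₗ[k] Q),
      (∀ f p n, q (ra f p) n = q p (la f n)) ∧
      (∀ (W : ModuleCat.{u} k) (a b : Q ⟶ W), (∀ p n, a.hom (q p n) = b.hom (q p n)) → a = b) ∧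
      (∀ (W : ModuleCat.{u} k) (r : P →ₗ[k] N →ₗ[k] W),
        (∀ f p n, r (ra f p) n = r p (la f n)) → ∃ a : Q ⟶ W, ∀ p n, a.hom (q p n) = r p n) := by
  refine ⟨ModuleCat.of k (BalancedTensor ra la), TensorProduct.curry (balancedRel ra la).mkQ,
    mk_balanced ra la, fun W a b h => ModuleCat.hom_ext (balanced_induction h), fun W r hr => ?_⟩
  refine ⟨ModuleCat.ofHom ((balancedRel ra la).liftQ (TensorProduct.lift r)
    (balancedRel_le_ker _ fun f p n => ?_)), fun p n => rfl⟩
  rw [TensorProduct.lift.tmul, TensorProduct.lift.tmul, hr]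

end Balanced

end BalancedTensor

/-- A right comodule over the `k`-coalgebra `C`. -/
structure Comod (k : Type u) [Field k] (C : Type u) [AddCommGroup C] [Module k C]
    [Coalgebra k C] where
  carrier : Type u
  [addCommGroup : AddCommGroup carrier]
  [module : Module k carrier]
  /-- The coaction `M → M ⊗ C`. -/
  coact : carrier →ₗ[k] carrier ⊗[k] C
  coassoc : (TensorProduct.assoc k carrier C C).toLinearMap ∘ₗ coact.rTensor C ∘ₗ coact =
    (Coalgebra.comul (R := k)).lTensor carrier ∘ₗ coact
  counit_coact : (TensorProduct.rid k carrier).toLinearMap ∘ₗ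
    (Coalgebra.counit (R := k) (A := C)).lTensor carrier ∘ₗ coact = LinearMap.id

attribute [instance] Comod.addCommGroup Comod.module

variable {k : Type u} [Field k] {C : Type u} [AddCommGroup C] [Module k C] [Coalgebra k C]

namespace Comod

/-- Morphisms of right comodules: the linear maps which commute with the coactions. -/
@[ext]
structure Hom (M N : Comod k C) where
  lin : M.carrier →ₗ[k] N.carrier
  comm : N.coact ∘ₗ lin = lin.rTensor C ∘ₗ M.coact

instance : Category (Comod k C) where
  Hom M N := Hom M N
  id M := ⟨LinearMap.id, by simp⟩
  comp f g := ⟨g.lin ∘ₗ f.lin, by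
    rw [← LinearMap.comp_assoc, g.comm, LinearMap.comp_assoc, f.comm, LinearMap.rTensor_comp,
      LinearMap.comp_assoc]⟩

@[ext]
lemma hom_ext {M N : Comod k C} {f g : M ⟶ N} (h : f.lin = g.lin) : f = g := Hom.ext h

@[simp] lemma id_lin (M : Comod k C) : Hom.lin (𝟙 M) = LinearMap.id := rfl

@[simp] lemma comp_lin {M N P : Comod k C} (f : M ⟶ N) (g : N ⟶ P) :
    Hom.lin (f ≫ g) = g.lin ∘ₗ f.lin := rfl

section HomModule

variable (M N : Comod k C)

lemma lin_injective : Function.Injective (fun f : M ⟶ N => f.lin) := fun _ _ h => hom_ext h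

instance : Zero (M ⟶ N) := ⟨⟨0, by simp⟩⟩
instance : Add (M ⟶ N) := ⟨fun f g => ⟨f.lin + g.lin, by
  rw [LinearMap.comp_add, f.comm, g.comm, LinearMap.rTensor_add, LinearMap.add_comp]⟩⟩
instance : Neg (M ⟶ N) := ⟨fun f => ⟨-f.lin, by
  rw [LinearMap.comp_neg, f.comm, LinearMap.rTensor_neg, LinearMap.neg_comp]⟩⟩
instance : Sub (M ⟶ N) := ⟨fun f g => ⟨f.lin - g.lin, by
  rw [LinearMap.comp_sub, f.comm, g.comm, LinearMap.rTensor_sub, LinearMap.sub_comp]⟩⟩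
instance : SMul ℕ (M ⟶ N) := ⟨fun n f => ⟨n • f.lin, by
  change _ = (LinearMap.rTensorHom C (n • f.lin)) ∘ₗ _
  rw [map_nsmul, LinearMap.comp_smul, f.comm]; rfl⟩⟩
instance : SMul ℤ (M ⟶ N) := ⟨fun n f => ⟨n • f.lin, by
  change _ = (LinearMap.rTensorHom C (n • f.lin)) ∘ₗ _
  rw [map_zsmul, LinearMap.comp_smul, f.comm]; rfl⟩⟩
instance : SMul k (M ⟶ N) := ⟨fun a f => ⟨a • f.lin, by
  rw [LinearMap.comp_smul, f.comm, LinearMap.rTensor_smul, LinearMap.smul_comp]⟩⟩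

instance : AddCommGroup (M ⟶ N) :=
  (lin_injective M N).addCommGroup _ rfl (fun _ _ => rfl) (fun _ => rfl) (fun _ _ => rfl)
    (fun _ _ => rfl) (fun _ _ => rfl)

/-- Taking the underlying linear map, as an additive map. -/
def linAddHom : (M ⟶ N) →+ (M.carrier →ₗ[k] N.carrier) where
  toFun f := f.lin
  map_zero' := rfl
  map_add' _ _ := rfl

instance : Module k (M ⟶ N) :=
  Function.Injective.module k (linAddHom M N) (lin_injective M N) (fun _ _ => rfl)

variable {M N}

@[simp] lemma add_lin (f g : M ⟶ N) : Hom.lin (f + g) = f.lin + g.lin := rfl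
@[simp] lemma zero_lin : Hom.lin (0 : M ⟶ N) = 0 := rfl
@[simp] lemma smul_lin (a : k) (f : M ⟶ N) : Hom.lin (a • f) = a • f.lin := rfl

end HomModule

instance : Preadditive (Comod k C) where
  add_comp _ _ _ f f' g := by ext1; simp [LinearMap.comp_add]
  comp_add _ _ _ f g g' := by ext1; simp [LinearMap.add_comp]

instance : Linear k (Comod k C) where
  smul_comp _ _ _ r f g := by ext1; simp [LinearMap.comp_smul]
  comp_smul _ _ _ f r g := by ext1; simp [LinearMap.smul_comp]

/-- The action `f ⇀ m = f(m₁) m₀` of `f ∈ C*` on a right comodule. -/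
def act (M : Comod k C) (f : C →ₗ[k] k) : M.carrier →ₗ[k] M.carrier :=
  slice M.carrier f ∘ₗ M.coact

lemma act_apply (M : Comod k C) (f : C →ₗ[k] k) (m : M.carrier) :
    M.act f m = slice M.carrier f (M.coact m) := rfl

lemma lin_act {M N : Comod k C} (g : M ⟶ N) (f : C →ₗ[k] k) (m : M.carrier) :
    g.lin (M.act f m) = N.act f (g.lin m) := by
  have h := LinearMap.congr_fun g.comm m
  simp only [LinearMap.comp_apply] at h
  rw [act_apply, act_apply, h, slice_rTensor]

/-- A linear map which respects the actions of `C*` is a morphism of comodules. -/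
def homOfAct {M N : Comod k C} (g : M.carrier →ₗ[k] N.carrier)
    (h : ∀ f m, g (M.act f m) = N.act f (g m)) : M ⟶ N where
  lin := g
  comm := by
    ext m
    apply slice_ext
    intro f
    simp only [LinearMap.comp_apply]
    rw [slice_rTensor, ← act_apply, ← act_apply, h]

/-- A linear map `δ : N → N ⊗ C` is a coaction as soon as `f ⇀ n = (id ⊗ f) δ(n)` defines a left
action of the algebra `C*`. -/
abbrev ofSlice (N : Type u) [AddCommGroup N] [Module k N] (δ : N →ₗ[k] N ⊗[k] C)
    (hmul : ∀ (f g : C →ₗ[k] k) (n : N), slice N f (δ (slice N g (δ n))) =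
      slice N (WithConv.toConv f * WithConv.toConv g).ofConv (δ n))
    (hone : ∀ n : N, slice N (Coalgebra.counit (R := k)) (δ n) = n) : Comod k C where
  carrier := N
  coact := δ
  coassoc := by
    ext n
    apply (TensorProduct.assoc k N C C).symm.injective
    simp only [LinearMap.comp_apply, LinearEquiv.coe_coe, LinearEquiv.symm_apply_apply]
    apply slice_ext
    intro g
    apply slice_ext
    intro f
    rw [slice_slice_comul, slice_rTensor, hmul]
  counit_coact := LinearMap.ext hone

/-- The right regular comodule `C`. -/
abbrev regular (k : Type u) [Field k] (C : Type u) [AddCommGroup C] [Module k C] [Coalgebra k C] :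
    Comod k C where
  carrier := C
  coact := Coalgebra.comul
  coassoc := Coalgebra.coassoc
  counit_coact := by ext c; simp

lemma act_act (M : Comod k C) (f g : C →ₗ[k] k) (m : M.carrier) :
    M.act f (M.act g m) = M.act (WithConv.toConv f * WithConv.toConv g).ofConv m := by
  have h := LinearMap.congr_fun M.coassoc m
  simp only [LinearMap.comp_apply, LinearEquiv.coe_coe] at h
  rw [← LinearEquiv.eq_symm_apply] at h
  simp only [act_apply]
  rw [← slice_slice_comul, ← h, slice_rTensor]

lemma act_counit (M : Comod k C) (m : M.carrier) : M.act (Coalgebra.counit (R := k)) m = m :=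
  LinearMap.congr_fun M.counit_coact m

/-! ### Copowers -/

/-- The map `id_W ⊗ δ_X`. -/
def copowerCoact (W : Type u) [AddCommGroup W] [Module k W] (X : Comod k C) :
    W ⊗[k] X.carrier →ₗ[k] (W ⊗[k] X.carrier) ⊗[k] C :=
  (TensorProduct.assoc k W X.carrier C).symm.toLinearMap ∘ₗ X.coact.lTensor W

lemma slice_copowerCoact (W : Type u) [AddCommGroup W] [Module k W] (X : Comod k C)
    (f : C →ₗ[k] k) (t : W ⊗[k] X.carrier) :
    slice (W ⊗[k] X.carrier) f (copowerCoact W X t) = (X.act f).lTensor W t := by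
  simp only [copowerCoact, LinearMap.comp_apply, LinearEquiv.coe_coe]
  induction t with
  | zero => simp
  | add x y hx hy => simp only [map_add, hx, hy]
  | tmul w x =>
    simp only [LinearMap.lTensor_tmul, act_apply]
    generalize X.coact x = s
    induction s with
    | zero => simp
    | add x y hx hy => simp only [map_add, tmul_add, hx, hy]
    | tmul a b => simp

/-- The comodule `W ⊗ X` with coaction `id_W ⊗ δ_X`. -/
abbrev copowerObj (W : Type u) [AddCommGroup W] [Module k W] (X : Comod k C) : Comod k C :=
  ofSlice (W ⊗[k] X.carrier) (copowerCoact W X)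
    (by
      intro f g t
      simp only [slice_copowerCoact]
      rw [← LinearMap.comp_apply, ← LinearMap.lTensor_comp]
      congr 2
      ext x
      exact X.act_act f g x)
    (by
      intro t
      have : X.act (Coalgebra.counit (R := k)) = LinearMap.id := by
        ext x
        exact X.act_counit x
      rw [slice_copowerCoact, this, LinearMap.lTensor_id, LinearMap.id_apply])

lemma copowerObj_act (W : Type u) [AddCommGroup W] [Module k W] (X : Comod k C)
    (f : C →ₗ[k] k) (t : W ⊗[k] X.carrier) :
    (copowerObj W X).act f t = (X.act f).lTensor W t := slice_copowerCoact W X f t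

/-- The functor `(W, X) ↦ W ⊗ X`. -/
def copower (k : Type u) [Field k] (C : Type u) [AddCommGroup C] [Module k C] [Coalgebra k C] :
    ModuleCat.{u} k ⥤ Comod k C ⥤ Comod k C where
  obj W :=
    { obj := fun X => copowerObj W X
      map := fun {X Y} g => homOfAct (M := copowerObj W X) (N := copowerObj W Y)
        (g.lin.lTensor W) (by
          intro f t
          rw [copowerObj_act, copowerObj_act, ← LinearMap.comp_apply, ← LinearMap.comp_apply,
            ← LinearMap.lTensor_comp, ← LinearMap.lTensor_comp]
          congr 2
          ext x
          exact lin_act g f x)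
      map_id := fun X => hom_ext (LinearMap.lTensor_id _ _)
      map_comp := fun f g => hom_ext (LinearMap.lTensor_comp _ _ _) }
  map {W W'} a :=
    { app := fun X => homOfAct (M := copowerObj W X) (N := copowerObj W' X)
        (a.hom.rTensor X.carrier) (by
          intro f t
          rw [copowerObj_act, copowerObj_act, ← LinearMap.comp_apply, ← LinearMap.comp_apply,
            LinearMap.lTensor_comp_rTensor, LinearMap.rTensor_comp_lTensor])
      naturality := fun X Y g => hom_ext (by
        change a.hom.rTensor Y.carrier ∘ₗ g.lin.lTensor W =
          g.lin.lTensor W' ∘ₗ a.hom.rTensor X.carrier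
        rw [LinearMap.lTensor_comp_rTensor, LinearMap.rTensor_comp_lTensor]) }
  map_id W := by
    ext X : 2
    exact hom_ext (LinearMap.rTensor_id _ _)
  map_comp f g := by
    ext X : 2
    exact hom_ext (LinearMap.rTensor_comp _ _ _)

end Comod

/-! ### Rational modules over the convolution algebra `C*` -/

section Rational

/-- The dual space `C*` with the convolution product `(f * g)(c) = f(c₁) g(c₂)`. -/
abbrev DualAlg (k : Type u) [Field k] (C : Type u) [AddCommGroup C] [Module k C]
    [Coalgebra k C] : Type u := WithConv (C →ₗ[k] k)

variable (k C)
variable (N : Type u) [AddCommGroup N] [Module k N] [Module (DualAlg k C) N]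
  [IsScalarTower k (DualAlg k C) N]

/-- The rational part `N^rat` of a left `C*`-module `N`: the elements `n` for which there is
`∑ nᵢ ⊗ cᵢ ∈ N ⊗ C` with `f • n = ∑ f(cᵢ) nᵢ` for all `f ∈ C*`. -/
def ratPart : Submodule (DualAlg k C) N where
  carrier := {n | ∃ t : N ⊗[k] C, ∀ f : DualAlg k C, slice N f.ofConv t = f • n}
  add_mem' := by
    rintro a b ⟨s, hs⟩ ⟨t, ht⟩
    exact ⟨s + t, fun f => by rw [map_add, hs, ht, smul_add]⟩
  zero_mem' := ⟨0, fun f => by simp⟩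
  smul_mem' := by
    rintro g n ⟨t, ht⟩
    refine ⟨slice (N ⊗[k] C) g.ofConv ((TensorProduct.assoc k N C C).symm
      ((Coalgebra.comul (R := k)).lTensor N t)), fun f => ?_⟩
    rw [slice_slice_comul, ← mul_smul, ← ht]

/-- Every `C*`-linear map from a comodule into `N` takes values in the rational part. -/
lemma mem_ratPart_of_comod (X : Comod k C) (g : X.carrier →ₗ[k] N)
    (hg : ∀ f x, g (X.act f x) = WithConv.toConv f • g x) (x : X.carrier) :
    g x ∈ ratPart k C N :=
  ⟨g.rTensor C (X.coact x), fun f => by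
    rw [slice_rTensor, ← Comod.act_apply, hg, WithConv.toConv_ofConv]⟩

lemma exists_ratCoact (n : ratPart k C N) :
    ∃ t : (ratPart k C N) ⊗[k] C, ∀ f : DualAlg k C,
      slice (ratPart k C N) f.ofConv t = f • n := by
  obtain ⟨t, ht⟩ := n.2
  obtain ⟨s, hs⟩ := exists_of_slice_mem ((ratPart k C N).restrictScalars k) t (fun f => by
    have := ht (WithConv.toConv f)
    rw [WithConv.ofConv_toConv] at this
    rw [this]
    exact (ratPart k C N).smul_mem _ n.2)
  refine ⟨s, fun f => Subtype.ext ?_⟩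
  have h1 := slice_rTensor ((ratPart k C N).restrictScalars k).subtype f.ofConv s
  rw [hs, ht] at h1
  exact h1.symm

/-- The coaction on the rational part, characterized by `f • n = (id ⊗ f) δ(n)`. -/
def ratCoact : ratPart k C N →ₗ[k] (ratPart k C N) ⊗[k] C where
  toFun n := (exists_ratCoact k C N n).choose
  map_add' m n := by
    refine slice_ext (N := ratPart k C N) fun f => ?_
    rw [map_add]
    have h1 := (exists_ratCoact k C N (m + n)).choose_spec (WithConv.toConv f)
    have h2 := (exists_ratCoact k C N m).choose_spec (WithConv.toConv f)
    have h3 := (exists_ratCoact k C N n).choose_spec (WithConv.toConv f)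
    rw [WithConv.ofConv_toConv] at h1 h2 h3
    rw [h1, h2, h3, smul_add]
  map_smul' a n := by
    refine slice_ext (N := ratPart k C N) fun f => ?_
    rw [map_smul]
    have h1 := (exists_ratCoact k C N (a • n)).choose_spec (WithConv.toConv f)
    have h2 := (exists_ratCoact k C N n).choose_spec (WithConv.toConv f)
    rw [WithConv.ofConv_toConv] at h1 h2
    rw [h1, RingHom.id_apply, h2, smul_comm]

lemma slice_ratCoact (f : C →ₗ[k] k) (n : ratPart k C N) :
    slice (ratPart k C N) f (ratCoact k C N n) = WithConv.toConv f • n :=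
  (exists_ratCoact k C N n).choose_spec (WithConv.toConv f)

/-- The rational part of a left `C*`-module, as a right `C`-comodule. -/
abbrev rat : Comod k C :=
  Comod.ofSlice (ratPart k C N) (ratCoact k C N)
    (by
      intro f g n
      simp only [slice_ratCoact]
      exact (mul_smul (WithConv.toConv f) (WithConv.toConv g) n).symm)
    (by
      intro n
      rw [slice_ratCoact]
      exact one_smul (DualAlg k C) n)

variable {N}
variable {N' : Type u} [AddCommGroup N'] [Module k N'] [Module (DualAlg k C) N']
  [IsScalarTower k (DualAlg k C) N']

/-- The restriction of a `C*`-linear map to the rational parts. -/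
def ratMap (g : N →ₗ[DualAlg k C] N') : rat k C N ⟶ rat k C N' :=
  have hg : ∀ n ∈ ratPart k C N, g n ∈ ratPart k C N' := by
    rintro n ⟨t, ht⟩
    refine ⟨(g.restrictScalars k).rTensor C t, fun f => ?_⟩
    rw [slice_rTensor, ht]
    exact g.map_smul f n
  Comod.homOfAct (M := rat k C N) (N := rat k C N') ((g.restrict hg).restrictScalars k) (by
    intro f n
    change (g.restrict hg) (slice (ratPart k C N) f (ratCoact k C N n)) =
      slice (ratPart k C N') f (ratCoact k C N' ((g.restrict hg) n))
    rw [slice_ratCoact, slice_ratCoact, map_smul])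

end Rational

/-! ### The Nakayama functors -/

section Regular

variable (f g h : C →ₗ[k] k) (c : C)

/-- The right action `c ↼ f = f(c₁) c₂` of `C*` on `C`. -/
def rightAct (f : C →ₗ[k] k) : C →ₗ[k] C :=
  (TensorProduct.lid k C).toLinearMap ∘ₗ f.rTensor C ∘ₗ Coalgebra.comul

/-- The left action `f ⇀ c = f(c₂) c₁` of `C*` on `C`. -/
def leftAct (f : C →ₗ[k] k) : C →ₗ[k] C := slice C f ∘ₗ Coalgebra.comul

lemma regular_act : (Comod.regular k C).act f = leftAct f := rfl

lemma apply_rightAct : h (rightAct f c) = (WithConv.toConv f * WithConv.toConv h).ofConv c := by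
  rw [LinearMap.convMul_def]
  simp only [rightAct, LinearMap.comp_apply]
  generalize Coalgebra.comul (R := k) c = s
  induction s with
  | zero => simp
  | add x y hx hy => simp only [map_add, hx, hy]
  | tmul a b => simp

lemma apply_leftAct : h (leftAct f c) =
    (WithConv.toConv h * WithConv.toConv f).ofConv c := by
  rw [LinearMap.convMul_def]
  simp only [leftAct, LinearMap.comp_apply]
  generalize Coalgebra.comul (R := k) c = s
  induction s with
  | zero => simp
  | add x y hx hy => simp only [map_add, hx, hy]
  | tmul a b => simp [mul_comm]

lemma eq_of_dual (k : Type u) [Field k] {V : Type u} [AddCommGroup V] [Module k V] {x y : V}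
    (h : ∀ f : V →ₗ[k] k, f x = f y) : x = y := by
  rw [← sub_eq_zero, ← Module.forall_dual_apply_eq_zero_iff k]
  intro f
  rw [map_sub, h, sub_self]

lemma rightAct_rightAct : rightAct g (rightAct f c) =
    rightAct (WithConv.toConv f * WithConv.toConv g).ofConv c := by
  apply eq_of_dual k
  intro h
  rw [apply_rightAct, apply_rightAct, apply_rightAct]
  simp only [WithConv.toConv_ofConv, mul_assoc]

lemma leftAct_leftAct : leftAct f (leftAct g c) =
    leftAct (WithConv.toConv f * WithConv.toConv g).ofConv c := by
  apply eq_of_dual k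
  intro h
  rw [apply_leftAct, apply_leftAct, apply_leftAct]
  simp only [WithConv.toConv_ofConv, mul_assoc]

lemma leftAct_counit : leftAct (Coalgebra.counit (R := k)) c = c := by
  simp [leftAct, slice]

lemma rightAct_leftAct : rightAct f (leftAct g c) = leftAct g (rightAct f c) := by
  apply eq_of_dual k
  intro h
  rw [apply_rightAct, apply_leftAct, apply_leftAct, apply_rightAct]
  simp only [WithConv.toConv_ofConv, mul_assoc]

lemma rightAct_counit : rightAct (Coalgebra.counit (R := k)) c = c := by
  simp [rightAct]

lemma rightAct_add : rightAct (f + g) c = rightAct f c + rightAct g c := by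
  simp [rightAct, LinearMap.rTensor_add]

lemma rightAct_zero : rightAct (0 : C →ₗ[k] k) c = 0 := by
  simp [rightAct]

lemma rightAct_smul (a : k) : rightAct (a • f) c = a • rightAct f c := by
  simp [rightAct, LinearMap.rTensor_smul]

/-- The map `c ↦ c ↼ f` as an endomorphism of the right comodule `C`. -/
def rightActHom (f : C →ₗ[k] k) : Comod.regular k C ⟶ Comod.regular k C :=
  Comod.homOfAct (M := Comod.regular k C) (N := Comod.regular k C) (rightAct f)
    (fun g c => rightAct_leftAct f g c)

/-- `Hom^C(C, M)` as a left `C*`-module: `(f • ξ)(c) = ξ(c ↼ f) = f(c₁) ξ(c₂)`. -/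
instance regularHomModule (M : Comod k C) : Module (DualAlg k C) (Comod.regular k C ⟶ M) where
  smul f ξ := rightActHom f.ofConv ≫ ξ
  one_smul ξ := by
    ext c
    exact congrArg ξ.lin (rightAct_counit c)
  mul_smul f g ξ := by
    ext c
    exact congrArg ξ.lin (rightAct_rightAct f.ofConv g.ofConv c).symm
  smul_zero f := comp_zero
  smul_add f ξ η := Preadditive.comp_add _ _ _ _ _ _
  add_smul f g ξ := by
    ext c
    exact (congrArg ξ.lin (rightAct_add f.ofConv g.ofConv c)).trans (map_add ξ.lin _ _)
  zero_smul ξ := by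
    ext c
    exact (congrArg ξ.lin (rightAct_zero c)).trans (map_zero ξ.lin)

lemma smul_regularHom (M : Comod k C) (f : DualAlg k C) (ξ : Comod.regular k C ⟶ M) :
    f • ξ = rightActHom f.ofConv ≫ ξ := rfl

instance (M : Comod k C) : IsScalarTower k (DualAlg k C) (Comod.regular k C ⟶ M) where
  smul_assoc a f ξ := by
    ext c
    exact (congrArg ξ.lin (rightAct_smul f.ofConv c a)).trans (map_smul ξ.lin a _)

end Regular

variable (k C)

/-- The left exact Nakayama functor `M ↦ Hom^C(C, M)^rat`. -/
def nakL : Comod k C ⥤ Comod k C where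
  obj M := rat k C (Comod.regular k C ⟶ M)
  map {M M'} g := ratMap k C
    { toFun := fun ξ => ξ ≫ g
      map_add' := fun ξ η => Preadditive.add_comp _ _ _ _ _ _
      map_smul' := fun f ξ => by
        simp only [smul_regularHom, Category.assoc, RingHom.id_apply] }
  map_id M :=
    Comod.hom_ext (LinearMap.ext fun ξ => Subtype.ext (Category.comp_id ξ.1))
  map_comp f g :=
    Comod.hom_ext (LinearMap.ext fun ξ => Subtype.ext (Category.assoc ξ.1 f g).symm)

variable {k C}

/-- The underlying space `C ⊗_{C*} M`. -/
abbrev NakRSpace (M : Comod k C) : Type u := BalancedTensor (rightAct (k := k) (C := C)) M.act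

/-- The map `C ⊗ M → (C ⊗_{C*} M) ⊗ C`, `c ⊗ m ↦ [c₁ ⊗ m] ⊗ c₂`. -/
def nakRCoactAux (M : Comod k C) : C ⊗[k] M.carrier →ₗ[k] NakRSpace M ⊗[k] C :=
  (balancedRel rightAct M.act).mkQ.rTensor C ∘ₗ
    (TensorProduct.rightComm k C C M.carrier).toLinearMap ∘ₗ
    (Coalgebra.comul (R := k) (A := C)).rTensor M.carrier

lemma slice_nakRCoactAux (M : Comod k C) (f : C →ₗ[k] k) (c : C) (m : M.carrier) :
    slice (NakRSpace M) f (nakRCoactAux M (c ⊗ₜ m)) =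
      (balancedRel rightAct M.act).mkQ (leftAct f c ⊗ₜ m) := by
  simp only [nakRCoactAux, LinearMap.comp_apply, slice_rTensor, LinearMap.rTensor_tmul,
    leftAct]
  congr 1
  generalize Coalgebra.comul (R := k) c = s
  induction s with
  | zero => simp
  | add x y hx hy => simp only [map_add, add_tmul] at hx hy ⊢; rw [hx, hy]
  | tmul a b => simp [smul_tmul']

/-- The coaction `[c ⊗ m] ↦ [c₁ ⊗ m] ⊗ c₂` on `C ⊗_{C*} M`. -/
def nakRCoact (M : Comod k C) : NakRSpace M →ₗ[k] NakRSpace M ⊗[k] C :=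
  (balancedRel rightAct M.act).liftQ (nakRCoactAux M) (balancedRel_le_ker _ (by
    intro f c m
    apply slice_ext
    intro g
    rw [slice_nakRCoactAux, slice_nakRCoactAux, ← mk_balanced, rightAct_leftAct]))

lemma slice_nakRCoact (M : Comod k C) (f : C →ₗ[k] k) (c : C) (m : M.carrier) :
    slice (NakRSpace M) f (nakRCoact M ((balancedRel rightAct M.act).mkQ (c ⊗ₜ m))) =
      (balancedRel rightAct M.act).mkQ (leftAct f c ⊗ₜ m) := by
  rw [nakRCoact, Submodule.mkQ_apply, Submodule.liftQ_apply, slice_nakRCoactAux]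

/-- `C ⊗_{C*} M` as a right comodule. -/
abbrev nakRObj (M : Comod k C) : Comod k C :=
  Comod.ofSlice (NakRSpace M) (nakRCoact M)
    (by
      intro f g t
      refine LinearMap.congr_fun (f := slice _ f ∘ₗ nakRCoact M ∘ₗ slice _ g ∘ₗ nakRCoact M)
        (g := slice _ _ ∘ₗ nakRCoact M) (balanced_induction fun c m => ?_) t
      simp only [LinearMap.comp_apply]
      rw [slice_nakRCoact, slice_nakRCoact, slice_nakRCoact, leftAct_leftAct])
    (by
      intro t
      refine LinearMap.congr_fun (f := slice _ _ ∘ₗ nakRCoact M)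
        (g := LinearMap.id) (balanced_induction fun c m => ?_) t
      simp only [LinearMap.comp_apply]
      rw [slice_nakRCoact, leftAct_counit]
      rfl)

/-- The map `[c ⊗ m] ↦ [c ⊗ g(m)]`. -/
def nakRMapLin {M M' : Comod k C} (g : M ⟶ M') : NakRSpace M →ₗ[k] NakRSpace M' :=
  (balancedRel rightAct M.act).liftQ
    ((balancedRel rightAct M'.act).mkQ ∘ₗ g.lin.lTensor C) (balancedRel_le_ker _ (by
      intro f c m
      simp only [LinearMap.comp_apply, LinearMap.lTensor_tmul]
      rw [mk_balanced, Comod.lin_act]))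

lemma nakRMapLin_mk {M M' : Comod k C} (g : M ⟶ M') (c : C) (m : M.carrier) :
    nakRMapLin g ((balancedRel rightAct M.act).mkQ (c ⊗ₜ m)) =
      (balancedRel rightAct M'.act).mkQ (c ⊗ₜ g.lin m) := by
  rw [nakRMapLin, Submodule.mkQ_apply, Submodule.liftQ_apply]
  rfl

variable (k C)

/-- The right exact Nakayama functor `M ↦ C ⊗_{C*} M`. -/
def nakR : Comod k C ⥤ Comod k C where
  obj M := nakRObj M
  map {M M'} g := Comod.homOfAct (M := nakRObj M) (N := nakRObj M') (nakRMapLin g) (by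
    intro f t
    refine LinearMap.congr_fun (f := nakRMapLin g ∘ₗ slice _ f ∘ₗ nakRCoact M)
        (g := slice _ f ∘ₗ nakRCoact M' ∘ₗ nakRMapLin g) (balanced_induction fun c m => ?_) t
    simp only [LinearMap.comp_apply]
    rw [slice_nakRCoact, nakRMapLin_mk, nakRMapLin_mk, slice_nakRCoact])
  map_id M := Comod.hom_ext (balanced_induction fun c m => nakRMapLin_mk _ c m)
  map_comp f g := Comod.hom_ext (balanced_induction fun c m =>
    (nakRMapLin_mk (f ≫ g) c m).trans
      ((congrArg (nakRMapLin g) (nakRMapLin_mk f c m)).trans (nakRMapLin_mk g c _)).symm)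

variable {k C}

/-! ### The coHom functor -/

section CoHom

/-- The functor `W ↦ Hom^C(Y, W ⊗ X)`. -/
def coHomFunctor (X Y : Comod k C) : ModuleCat.{u} k ⥤ Type u :=
  (Comod.copower k C).flip.obj X ⋙ coyoneda.obj (op Y)

/-- The space `coHom^C(X, Y)`: the object representing `W ↦ Hom^C(Y, W ⊗ X)`, if it exists. -/
def coHom (X Y : Comod k C) [(coHomFunctor X Y).IsCorepresentable] : ModuleCat.{u} k :=
  (coHomFunctor X Y).coreprX

/-- The bijection `Hom_k(coHom^C(X, Y), W) ≃ Hom^C(Y, W ⊗ X)`. -/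
def coHomEquiv (X Y : Comod k C) [(coHomFunctor X Y).IsCorepresentable] (W : ModuleCat.{u} k) :
    (coHom X Y ⟶ W) ≃ (Y ⟶ ((Comod.copower k C).obj W).obj X) :=
  (coHomFunctor X Y).corepresentableBy.homEquiv

lemma coHomEquiv_comp (X Y : Comod k C) [(coHomFunctor X Y).IsCorepresentable]
    {W W' : ModuleCat.{u} k} (a : coHom X Y ⟶ W) (b : W ⟶ W') :
    coHomEquiv X Y W' (a ≫ b) = coHomEquiv X Y W a ≫ ((Comod.copower k C).map b).app X :=
  (coHomFunctor X Y).corepresentableBy.homEquiv_comp b a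

variable (X M : Comod k C)

/-- The action of `C*` on the dual space: `(φ ↼ f)(x) = φ(f ⇀ x)`. -/
def dualAct (f : C →ₗ[k] k) : (X.carrier →ₗ[k] k) →ₗ[k] (X.carrier →ₗ[k] k) :=
  (X.act f).dualMap

lemma slice_lTensor_act {W : Type u} [AddCommGroup W] [Module k W] (f : C →ₗ[k] k)
    (φ : X.carrier →ₗ[k] k) (t : W ⊗[k] X.carrier) :
    slice W φ ((X.act f).lTensor W t) = slice W (dualAct X f φ) t := by
  induction t with
  | zero => simp
  | add x y hx hy => simp only [map_add, hx, hy]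
  | tmul w x => simp [dualAct]

variable {X M}

/-- For `X` finite-dimensional, a balanced bilinear map `q : X* × M → W` yields the comodule map
`m ↦ ∑ q(xᵢ*, m) ⊗ xᵢ`. -/
lemma exists_hom_of_balanced [Module.Finite k X.carrier] {W : Type u} [AddCommGroup W]
    [Module k W] (q : (X.carrier →ₗ[k] k) →ₗ[k] M.carrier →ₗ[k] W)
    (hq : ∀ f φ m, q (dualAct X f φ) m = q φ (M.act f m)) :
    ∃ u : M ⟶ Comod.copowerObj W X, ∀ (φ : X.carrier →ₗ[k] k) (m : M.carrier),
      slice W φ (u.lin m) = q φ m := by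
  let b := Module.finBasis k X.carrier
  let u : M.carrier →ₗ[k] W ⊗[k] X.carrier :=
    ∑ i, (TensorProduct.mk k W X.carrier).flip (b i) ∘ₗ q (b.coord i)
  have hu : ∀ (φ : X.carrier →ₗ[k] k) (m : M.carrier), slice W φ (u m) = q φ m := by
    intro φ m
    have hφ : φ = ∑ i, φ (b i) • b.coord i := by
      apply b.ext
      intro j
      simp
    conv_rhs => rw [hφ, map_sum, LinearMap.sum_apply]
    simp only [u, LinearMap.sum_apply, map_sum, LinearMap.comp_apply, LinearMap.flip_apply,
      TensorProduct.mk_apply, slice_tmul, map_smul, LinearMap.smul_apply]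
  refine ⟨Comod.homOfAct (N := Comod.copowerObj W X) u fun f m => ?_, hu⟩
  rw [Comod.copowerObj_act]
  refine slice_ext (N := W) fun φ => ?_
  rw [slice_lTensor_act, hu, hu, hq]

/-- A comodule map `g : M → W ⊗ X` yields the balanced bilinear map `(φ, m) ↦ (id ⊗ φ) g(m)`. -/
lemma exists_balanced_of_hom {W : Type u} [AddCommGroup W] [Module k W]
    (g : M ⟶ Comod.copowerObj W X) :
    ∃ q : (X.carrier →ₗ[k] k) →ₗ[k] M.carrier →ₗ[k] W,
      (∀ φ m, q φ m = slice W φ (g.lin m)) ∧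
      ∀ f φ m, q (dualAct X f φ) m = q φ (M.act f m) := by
  refine ⟨LinearMap.mk₂ k (fun φ m => slice W φ (g.lin m))
    (fun φ ψ m => ?_) (fun r φ m => ?_) (fun φ m n => ?_) (fun r φ m => ?_),
    fun φ m => rfl, fun f φ m => ?_⟩
  · simp only [slice, LinearMap.lTensor_add, LinearMap.comp_add, LinearMap.add_apply]
  · simp only [slice, LinearMap.lTensor_smul, LinearMap.comp_smul, LinearMap.smul_apply]
  · rw [map_add, map_add]
  · rw [map_smul, map_smul]
  · change slice W (dualAct X f φ) (g.lin m) = slice W φ (g.lin (M.act f m))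
    rw [Comod.lin_act, Comod.copowerObj_act, slice_lTensor_act]

variable (X M)

/-- For `X` finite-dimensional, the space `coHom^C(X, M)` exists, namely `X* ⊗_{C*} M`. -/
instance isCorepresentable_coHomFunctor [Module.Finite k X.carrier] :
    (coHomFunctor X M).IsCorepresentable where
  has_corepresentation := by
    obtain ⟨P, q, hq, hqext, hqlift⟩ := exists_universal_balanced (dualAct X) M.act
    obtain ⟨u, hu⟩ := exists_hom_of_balanced q hq
    have key : ∀ {W : ModuleCat.{u} k} (a : P ⟶ W) (φ : X.carrier →ₗ[k] k) (m : M.carrier),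
        slice W φ (Comod.Hom.lin (u ≫ ((Comod.copower k C).map a).app X) m) =
          a.hom (q φ m) := by
      intro W a φ m
      refine (slice_rTensor a.hom φ (u.lin m)).trans ?_
      rw [hu]
    have bij : ∀ W : ModuleCat.{u} k, Function.Bijective
        (fun a : P ⟶ W => u ≫ ((Comod.copower k C).map a).app X) := by
      intro W
      constructor
      · intro a b hab
        refine hqext W a b fun φ m => ?_
        rw [← key, ← key]
        exact congrArg (fun h => slice W φ (Comod.Hom.lin h m)) hab
      · intro g
        obtain ⟨p, hp, hp'⟩ := exists_balanced_of_hom (W := W) g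
        obtain ⟨a, ha⟩ := hqlift W p hp'
        refine ⟨a, Comod.hom_ext (LinearMap.ext fun m => ?_)⟩
        refine slice_ext (N := W) fun φ => ?_
        exact (key a φ m).trans ((ha φ m).trans (hp φ m))
    refine ⟨P, ⟨{
      homEquiv := fun {W} => Equiv.ofBijective _ (bij W)
      homEquiv_comp := ?_ }⟩⟩
    intro W W' b a
    change u ≫ ((Comod.copower k C).map (a ≫ b)).app X =
      (u ≫ ((Comod.copower k C).map a).app X) ≫ ((Comod.copower k C).map b).app X
    rw [Functor.map_comp, NatTrans.comp_app]
    exact (Category.assoc u _ _).symm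

end CoHom

/-! ### Finite-dimensional comodules and the integrands -/

/-- The category of finite-dimensional right comodules. -/
abbrev FdComod (k : Type u) [Field k] (C : Type u) [AddCommGroup C] [Module k C]
    [Coalgebra k C] : Type (u + 1) :=
  ObjectProperty.FullSubcategory (fun X : Comod k C => Module.Finite k X.carrier)

/-- The inclusion of finite-dimensional comodules into all comodules. -/
abbrev fdInclusion (k : Type u) [Field k] (C : Type u) [AddCommGroup C] [Module k C]
    [Coalgebra k C] : FdComod k C ⥤ Comod k C :=
  ObjectProperty.ι _

instance (X : FdComod k C) : Module.Finite k X.obj.carrier := X.property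

/-- The functor `X ↦ coHom^C(X, M)` on finite-dimensional comodules; its value on `g : X ⟶ X'`
corresponds to the natural map `Hom^C(M, W ⊗ X) → Hom^C(M, W ⊗ X')`. -/
def coHomFd (M : Comod k C) : (FdComod k C)ᵒᵖ ⥤ ModuleCat.{u} k where
  obj X := coHom X.unop.obj M
  map {X' X} g := (coHomEquiv X'.unop.obj M (coHom X.unop.obj M)).symm
    (coHomEquiv X.unop.obj M _ (𝟙 _) ≫ ((Comod.copower k C).obj _).map g.unop.hom)
  map_id X := by
    rw [Equiv.symm_apply_eq, unop_id, ObjectProperty.FullSubcategory.id_hom, CategoryTheory.Functor.map_id,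
      Category.comp_id]
  map_comp {X Y Z} f g := by
    rw [Equiv.symm_apply_eq, coHomEquiv_comp, Equiv.apply_symm_apply]
    simp only [Category.assoc, NatTrans.naturality]
    rw [← Category.assoc, ← coHomEquiv_comp, Category.id_comp, Equiv.apply_symm_apply]
    simp

/-- The functor `(X, Y) ↦ Hom^C(X, M) ⊗ Y` with values in `C`-comodules. -/
def integrandL (M : Comod k C) : (FdComod k C)ᵒᵖ ⥤ FdComod k C ⥤ Comod k C :=
  ((fdInclusion k C).op ⋙ (linearYoneda k (Comod k C)).obj M) ⋙ Comod.copower k C ⋙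
    (Functor.whiskeringLeft _ _ _).obj (fdInclusion k C)

/-- The functor `(X, Y) ↦ coHom^C(X, M) ⊗ Y` with values in `C`-comodules. -/
def integrandR (M : Comod k C) : (FdComod k C)ᵒᵖ ⥤ FdComod k C ⥤ Comod k C :=
  coHomFd M ⋙ Comod.copower k C ⋙ (Functor.whiskeringLeft _ _ _).obj (fdInclusion k C)

/-- `E` is an end of `F`: there is a universal dinatural transformation from `E` to `F`. -/
def IsEnd {J : Type*} [Category J] {V : Type*} [Category V] (F : Jᵒᵖ ⥤ J ⥤ V) (E : V) : Prop :=
  ∃ (π : ∀ j : J, E ⟶ (F.obj (op j)).obj j)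
    (hπ : ∀ ⦃i j : J⦄ (f : i ⟶ j), π i ≫ (F.obj (op i)).map f = π j ≫ (F.map f.op).app j),
    Nonempty (IsLimit (Wedge.mk E π hπ))

/-- `E` is a coend of `F`: there is a universal dinatural transformation from `F` to `E`. -/
def IsCoend {J : Type*} [Category J] {V : Type*} [Category V] (F : Jᵒᵖ ⥤ J ⥤ V) (E : V) :
    Prop :=
  ∃ (ι : ∀ j : J, (F.obj (op j)).obj j ⟶ E)
    (hι : ∀ ⦃i j : J⦄ (f : i ⟶ j), (F.map f.op).app i ≫ ι i = (F.obj (op j)).map f ≫ ι j),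
    Nonempty (IsColimit (Cowedge.mk E ι hι))

end

end Nakayama

/-!
Everything rests on matrix coefficients. For a finite-dimensional comodule `X` and a functional `φ`
on `X`, the map `coeff φ : X → C`, `x ↦ φ(x₀) x₁`, is a morphism of comodules; every morphism
`g : X → C` has this form, for `φ = ε ∘ g` (`coeff_counitComp`); and every element of `C` lies in a
finite-dimensional subcomodule (`exists_fdComod_map_regular`).

*The end.* As `X` is finite-dimensional, an element of `Hom^C(X, M) ⊗ X` amounts to a family of
slices, linear in the functional `φ` on `X`. The universal wedge `nakLProj M X` sends
`ξ ∈ Hom^C(C, M)^rat` to the element whose slice along `φ` is `ξ ∘ coeff φ`. Conversely, for a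
wedge `π` from `E` and `e ∈ E`, the slices of `π_X(e)` along `ε ∘ g`, for `g : X → C`, are
compatible with morphisms in `X`, so they glue to a single morphism `ξ : C → M` (`exists_glue`).
As `ε(c ↼ f) = f(c)`, the map `e ↦ ξ` is `C*`-linear, and a `C*`-linear map from a comodule has
rational values.

*The coend.* Tensor-hom adjunction over `C*` makes the right exact Nakayama functor left adjoint to
the left exact one (`nakAdjunction`). Morphisms `coHom^C(X, M) ⊗ X → E` correspond to linear maps
`coHom^C(X, M) → Hom^C(X, E)`, hence to morphisms `M → Hom^C(X, E) ⊗ X`, and under this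
correspondence cowedges to `E` are wedges from `M` (`cowedge_condition_iff`). So both
`Hom(C ⊗_{C*} M, E)` and the set of cowedges to `E` are identified with `Hom(M, Hom^C(C, E)^rat)`.

*Invariance.* A linear equivalence `Φ` preserves copowers, `W ⊗ Φ X ≅ Φ (W ⊗ X)`, by their universal
property. It preserves finite-dimensional comodules (`finite_map_obj`): a morphism from a
finite-dimensional `X` to `W ⊗ Z` is a finite sum of morphisms `x ↦ w ⊗ g(x)`, and when this holds
for the coaction `Y → Y ⊗ D`, then `Y` is finite-dimensional. Hence `Φ` carries the end which is
`Hom^C(C, M)^rat` to the end for `Φ M`, naturally in `M`. For the right exact functors the claim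
follows by the uniqueness of left adjoints, applied to the inverse equivalence.
-/

namespace Nakayama

noncomputable section

variable {k : Type u} [Field k] {C : Type u} [AddCommGroup C] [Module k C] [Coalgebra k C]

/-! ### Slices -/

lemma slice_lTensor {N X Y : Type u} [AddCommGroup N] [Module k N] [AddCommGroup X] [Module k X]
    [AddCommGroup Y] [Module k Y] (φ : Y →ₗ[k] k) (g : X →ₗ[k] Y) (t : N ⊗[k] X) :
    slice N φ (g.lTensor N t) = slice N (φ ∘ₗ g) t := by
  induction t with
  | zero => simp
  | add x y hx hy => simp only [map_add, hx, hy]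
  | tmul n x => simp

lemma slice_add {N X : Type u} [AddCommGroup N] [Module k N] [AddCommGroup X] [Module k X]
    (φ ψ : X →ₗ[k] k) (t : N ⊗[k] X) : slice N (φ + ψ) t = slice N φ t + slice N ψ t := by
  simp only [slice, LinearMap.lTensor_add, LinearMap.comp_add, LinearMap.add_apply]

lemma slice_smul {N X : Type u} [AddCommGroup N] [Module k N] [AddCommGroup X] [Module k X]
    (a : k) (φ : X →ₗ[k] k) (t : N ⊗[k] X) : slice N (a • φ) t = a • slice N φ t := by
  simp only [slice, LinearMap.lTensor_smul, LinearMap.comp_smul, LinearMap.smul_apply]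

namespace Comod

/-! ### Finite-dimensional subcomodules -/

/-- The subcomodule of `M` on a subspace which is stable under the action of `C*`. Its coaction is
the restriction of that of `M`, which takes values in the image of `S ⊗ C` as all its slices lie
in `S`. -/
abbrev sub (M : Comod k C) (S : Submodule k M.carrier) (hS : ∀ f, ∀ x ∈ S, M.act f x ∈ S) :
    Comod k C :=
  have h (x : S) : ∃ t : S ⊗[k] C, S.subtype.rTensor C t = M.coact x :=
    exists_of_slice_mem S (M.coact x) fun f => hS f x x.2
  have inj : Function.Injective (S.subtype.rTensor C) :=
    Module.Flat.rTensor_preserves_injective_linearMap _ S.injective_subtype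
  let δ : S →ₗ[k] S ⊗[k] C :=
    { toFun := fun x => (h x).choose
      map_add' := fun x y => inj (by
        rw [map_add, (h (x + y)).choose_spec, (h x).choose_spec, (h y).choose_spec,
          Submodule.coe_add, map_add])
      map_smul' := fun a x => inj (by
        rw [map_smul, (h (a • x)).choose_spec, (h x).choose_spec, Submodule.coe_smul, map_smul,
          RingHom.id_apply]) }
  have hδ (f : C →ₗ[k] k) (x : S) : (slice S f (δ x) : M.carrier) = M.act f x := by
    rw [act_apply, ← (h x).choose_spec, slice_rTensor]
    rfl
  ofSlice S δ
    (fun f g x => Subtype.ext (by rw [hδ, hδ, hδ, act_act]))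
    (fun x => Subtype.ext (by rw [hδ, act_counit]))

variable (M : Comod k C) (S : Submodule k M.carrier) (hS : ∀ f, ∀ x ∈ S, M.act f x ∈ S)

lemma coe_sub_act (f : C →ₗ[k] k) (x : S) :
    (((M.sub S hS).act f x : S) : M.carrier) = M.act f x := by
  have h : ∃ t : S ⊗[k] C, S.subtype.rTensor C t = M.coact x :=
    exists_of_slice_mem S (M.coact x) fun f => hS f x x.2
  have := slice_rTensor S.subtype f h.choose
  rw [h.choose_spec] at this
  exact this.symm

/-- The inclusion of a subcomodule. -/
def subι : M.sub S hS ⟶ M :=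
  homOfAct (M := M.sub S hS) S.subtype fun f x => coe_sub_act M S hS f x

/-- A morphism whose values lie in a subcomodule, as a morphism into it. -/
def subLift {X : Comod k C} (g : X ⟶ M) (h : ∀ x, g.lin x ∈ S) : X ⟶ M.sub S hS :=
  homOfAct (N := M.sub S hS) (g.lin.codRestrict S h) fun f x => Subtype.ext (by
    rw [coe_sub_act, LinearMap.codRestrict_apply, LinearMap.codRestrict_apply, lin_act])

variable {M} in
lemma stable_sup {S S' : Submodule k M.carrier} (hS : ∀ f, ∀ x ∈ S, M.act f x ∈ S)
    (hS' : ∀ f, ∀ x ∈ S', M.act f x ∈ S') : ∀ f, ∀ x ∈ S ⊔ S', M.act f x ∈ S ⊔ S' := by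
  intro f x hx
  obtain ⟨y, hy, z, hz, rfl⟩ := Submodule.mem_sup.1 hx
  rw [map_add]
  exact add_mem (Submodule.mem_sup_left (hS f y hy)) (Submodule.mem_sup_right (hS' f z hz))

variable {M} in
lemma stable_range {X : Comod k C} (g : X ⟶ M) :
    ∀ f, ∀ x ∈ LinearMap.range g.lin, M.act f x ∈ LinearMap.range g.lin := by
  rintro f _ ⟨x, rfl⟩
  exact ⟨_, lin_act g f x⟩

/-- The subspace `C* ⇀ m` is finite-dimensional: it is contained in the span of the left tensor
factors of `δ(m)`. -/
lemma exists_finite_stable (m : M.carrier) : ∃ S : Submodule k M.carrier,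
    Module.Finite k S ∧ (∀ f, ∀ x ∈ S, M.act f x ∈ S) ∧ m ∈ S := by
  let T : (C →ₗ[k] k) →ₗ[k] M.carrier :=
    { toFun := fun f => M.act f m
      map_add' := fun f g => slice_add f g _
      map_smul' := fun a f => slice_smul a f _ }
  refine ⟨LinearMap.range T, ?_, ?_, ⟨Coalgebra.counit, M.act_counit m⟩⟩
  · obtain ⟨s, hs⟩ := TensorProduct.exists_finset (M.coact m)
    classical
    have : LinearMap.range T ≤ Submodule.span k (s.image Prod.fst : Set M.carrier) := by
      rintro _ ⟨f, rfl⟩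
      change slice _ f (M.coact m) ∈ _
      rw [hs, map_sum]
      refine Submodule.sum_mem _ fun i hi => ?_
      rw [slice_tmul]
      exact Submodule.smul_mem _ _ (Submodule.subset_span (by simpa using ⟨_, hi⟩))
    exact Submodule.finiteDimensional_of_le this
  · rintro f _ ⟨g, rfl⟩
    exact ⟨_, (M.act_act f g m).symm⟩

end Comod

/-! ### Matrix coefficients -/

section Coeff

variable {X Y : Comod k C}

/-- The matrix coefficient map `x ↦ φ(x₀) x₁` of a functional `φ` on a comodule, as a linear map. -/
def coeffLin (φ : X.carrier →ₗ[k] k) : X.carrier →ₗ[k] C :=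
  (TensorProduct.lid k C).toLinearMap ∘ₗ φ.rTensor C ∘ₗ X.coact

lemma apply_coeffLin (h : C →ₗ[k] k) (φ : X.carrier →ₗ[k] k) (x : X.carrier) :
    h (coeffLin φ x) = φ (X.act h x) := by
  simp only [coeffLin, LinearMap.comp_apply, Comod.act_apply]
  generalize X.coact x = t
  induction t with
  | zero => simp
  | add x y hx hy => simp only [map_add, hx, hy]
  | tmul x c => simp [mul_comm]

/-- The matrix coefficient map `x ↦ φ(x₀) x₁` as a morphism to the regular comodule. -/
def coeff (φ : X.carrier →ₗ[k] k) : X ⟶ Comod.regular k C :=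
  Comod.homOfAct (N := Comod.regular k C) (coeffLin φ) fun f x => eq_of_dual k fun g => by
    rw [regular_act, apply_leftAct, apply_coeffLin, apply_coeffLin, Comod.act_act]

lemma apply_coeff (h : C →ₗ[k] k) (φ : X.carrier →ₗ[k] k) (x : X.carrier) :
    h ((coeff φ).lin x) = φ (X.act h x) := apply_coeffLin h φ x

/-- The composite of a morphism `X → C` with the counit of `C`. -/
def counitComp (g : X ⟶ Comod.regular k C) : X.carrier →ₗ[k] k :=
  Coalgebra.counit (R := k) (A := C) ∘ₗ (g.lin : X.carrier →ₗ[k] C)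

/-- A morphism to the regular comodule is determined by its composite with the counit. -/
lemma coeff_counitComp (g : X ⟶ Comod.regular k C) : coeff (counitComp g) = g := by
  ext x
  refine eq_of_dual k fun h => ?_
  rw [apply_coeff, counitComp, LinearMap.comp_apply, Comod.lin_act, regular_act, apply_leftAct]
  exact congrArg (fun l : DualAlg k C => l.ofConv (g.lin x)) (one_mul (WithConv.toConv h))

lemma counitComp_coeff (φ : X.carrier →ₗ[k] k) : counitComp (coeff φ) = φ := by
  ext x
  rw [counitComp, LinearMap.comp_apply, apply_coeff, Comod.act_counit]

lemma coeff_add (φ ψ : X.carrier →ₗ[k] k) : coeff (φ + ψ) = coeff φ + coeff ψ := by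
  ext x
  refine eq_of_dual k fun h => ?_
  rw [Comod.add_lin, LinearMap.add_apply, map_add, apply_coeff, apply_coeff, apply_coeff]
  rfl

lemma coeff_smul (a : k) (φ : X.carrier →ₗ[k] k) : coeff (a • φ) = a • coeff φ := by
  ext x
  refine eq_of_dual k fun h => ?_
  rw [Comod.smul_lin, LinearMap.smul_apply, map_smul, apply_coeff, apply_coeff]
  rfl

lemma comp_coeff (g : X ⟶ Y) (φ : Y.carrier →ₗ[k] k) : g ≫ coeff φ = coeff (φ ∘ₗ g.lin) := by
  ext x
  refine eq_of_dual k fun h => ?_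
  rw [Comod.comp_lin, LinearMap.comp_apply, apply_coeff, apply_coeff, LinearMap.comp_apply,
    Comod.lin_act]

lemma coeff_comp_rightActHom (f : C →ₗ[k] k) (φ : X.carrier →ₗ[k] k) :
    coeff φ ≫ rightActHom f = coeff (dualAct X f φ) := by
  ext x
  refine eq_of_dual k fun h => ?_
  rw [apply_coeff, Comod.comp_lin, LinearMap.comp_apply]
  change h (rightAct f _) = φ (X.act f (X.act h x))
  rw [apply_rightAct, apply_coeff, Comod.act_act]

end Coeff

/-! ### The left exact Nakayama functor as an end -/

/-- The comodule `W ⊗ X`, as a value of the copower functor. -/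
abbrev tens (W : ModuleCat.{u} k) (X : Comod k C) : Comod k C :=
  ((Comod.copower k C).obj W).obj X

/-- The vector space `Hom^C(X, M)`. -/
abbrev homSpace (X M : Comod k C) : ModuleCat.{u} k := ModuleCat.of k (X ⟶ M)

/-- Precomposition with `g`, as a morphism of vector spaces. -/
abbrev precomp {X Y : Comod k C} (g : X ⟶ Y) (M : Comod k C) : homSpace Y M ⟶ homSpace X M :=
  ModuleCat.ofHom (Linear.leftComp k M g)

/-- Postcomposition with `g`, as a morphism of vector spaces. -/
abbrev postcomp (X : Comod k C) {M M' : Comod k C} (g : M ⟶ M') :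
    homSpace X M ⟶ homSpace X M' :=
  ModuleCat.ofHom (Linear.rightComp k X g)

section LeftEnd

lemma nakL_act (M : Comod k C) (f : C →ₗ[k] k) (n : ratPart k C (Comod.regular k C ⟶ M)) :
    ((nakL k C).obj M).act f n = WithConv.toConv f • n :=
  slice_ratCoact k C _ f n

lemma coe_nakL_act (M : Comod k C) (f : C →ₗ[k] k)
    (n : ratPart k C (Comod.regular k C ⟶ M)) :
    (((nakL k C).obj M).act f n : ratPart k C (Comod.regular k C ⟶ M)).1 =
      rightActHom f ≫ n.1 := by
  rw [nakL_act]
  rfl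

/-- The component `ξ ↦ ∑ (ξ ∘ coeff xᵢ*) ⊗ xᵢ` of the universal wedge, as a linear map. -/
def nakLProjLin (M X : Comod k C) [Module.Finite k X.carrier] :
    ratPart k C (Comod.regular k C ⟶ M) →ₗ[k] (X ⟶ M) ⊗[k] X.carrier :=
  ∑ i, (TensorProduct.mk k (X ⟶ M) X.carrier).flip (Module.finBasis k X.carrier i) ∘ₗ
    Linear.leftComp k M (coeff ((Module.finBasis k X.carrier).coord i)) ∘ₗ
      ((ratPart k C (Comod.regular k C ⟶ M)).restrictScalars k).subtype

lemma slice_nakLProjLin (M X : Comod k C) [Module.Finite k X.carrier] (φ : X.carrier →ₗ[k] k)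
    (n : ratPart k C (Comod.regular k C ⟶ M)) :
    slice (X ⟶ M) φ (nakLProjLin M X n) = coeff φ ≫ n.1 := by
  let b := Module.finBasis k X.carrier
  let T : (X.carrier →ₗ[k] k) →ₗ[k] (X ⟶ M) :=
    { toFun := fun φ => coeff φ ≫ n.1
      map_add' := fun φ ψ => by rw [coeff_add, Preadditive.add_comp]
      map_smul' := fun a φ => by rw [coeff_smul, Linear.smul_comp]; rfl }
  have hφ : φ = ∑ i, φ (b i) • b.coord i := b.ext fun j => by simp
  change _ = T φ
  conv_rhs => rw [hφ, map_sum]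
  simp only [nakLProjLin, LinearMap.sum_apply, map_sum, LinearMap.comp_apply,
    LinearMap.flip_apply, TensorProduct.mk_apply, slice_tmul, map_smul]
  rfl

/-- The component `Hom^C(C, M)^rat → Hom^C(X, M) ⊗ X` of the universal wedge. -/
def nakLProj (M X : Comod k C) [Module.Finite k X.carrier] :
    (nakL k C).obj M ⟶ tens (homSpace X M) X :=
  Comod.homOfAct (M := (nakL k C).obj M) (N := Comod.copowerObj (X ⟶ M) X) (nakLProjLin M X)
    fun f n => slice_ext (N := X ⟶ M) fun φ => by
      rw [Comod.copowerObj_act, slice_lTensor_act]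
      refine (slice_nakLProjLin M X φ _).trans
        (Eq.trans ?_ (slice_nakLProjLin M X (dualAct X f φ) n).symm)
      rw [← coeff_comp_rightActHom, Category.assoc]
      exact congrArg (coeff φ ≫ ·) (coe_nakL_act M f n)

lemma slice_nakLProj (M X : Comod k C) [Module.Finite k X.carrier] (φ : X.carrier →ₗ[k] k)
    (n : ratPart k C (Comod.regular k C ⟶ M)) :
    slice (X ⟶ M) φ ((nakLProj M X).lin n) = coeff φ ≫ n.1 :=
  slice_nakLProjLin M X φ n

/-- The dinaturality of a wedge over `integrandL M`, in terms of slices. -/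
lemma slice_wedge {M E : Comod k C}
    {π : ∀ X : FdComod k C, E ⟶ tens (homSpace X.obj M) X.obj} {X Y : FdComod k C} (g : X ⟶ Y)
    (hπ : π X ≫ ((Comod.copower k C).obj _).map g.hom =
      π Y ≫ ((Comod.copower k C).map (precomp g.hom M)).app Y.obj)
    (φ : Y.obj.carrier →ₗ[k] k) (e : E.carrier) :
    slice (X.obj ⟶ M) (φ ∘ₗ g.hom.lin) ((π X).lin e) =
      g.hom ≫ slice (Y.obj ⟶ M) φ ((π Y).lin e) := by
  have h := LinearMap.congr_fun (congrArg Comod.Hom.lin hπ) e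
  have h' := congrArg (slice (X.obj ⟶ M) φ) h
  refine (slice_lTensor φ g.hom.lin _).symm.trans (h'.trans ?_)
  exact slice_rTensor (Linear.leftComp k M g.hom) φ ((π Y).lin e)

/-- The morphisms `nakLProj M X` are dinatural in `X`, as `g ≫ coeff φ = coeff (φ ∘ g)`. -/
lemma nakLProj_wedge (M : Comod k C) ⦃X Y : FdComod k C⦄ (g : X ⟶ Y) :
    nakLProj M X.obj ≫ ((Comod.copower k C).obj _).map g.hom =
      nakLProj M Y.obj ≫ ((Comod.copower k C).map (precomp g.hom M)).app Y.obj := by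
  ext n
  refine slice_ext (N := X.obj ⟶ M) fun φ => ?_
  refine (slice_lTensor φ g.hom.lin _).trans (Eq.trans ?_
    (slice_rTensor (Linear.leftComp k M g.hom) φ ((nakLProj M Y.obj).lin n)).symm)
  refine (slice_nakLProj M X.obj _ n).trans (Eq.trans ?_
    (congrArg (g.hom ≫ ·) (slice_nakLProj M Y.obj φ n).symm))
  exact (congrArg (· ≫ n.1) (comp_coeff g.hom φ).symm).trans (Category.assoc _ _ _)

lemma nakL_map_nakLProj {M M' : Comod k C} (g : M ⟶ M') (X : Comod k C)
    [Module.Finite k X.carrier] :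
    (nakL k C).map g ≫ nakLProj M' X = nakLProj M X ≫
      ((Comod.copower k C).map (postcomp X g)).app X := by
  ext n
  refine slice_ext (N := X ⟶ M') fun φ => ?_
  refine (slice_nakLProj M' X φ _).trans (Eq.trans ?_
    (slice_rTensor (Linear.rightComp k X g) φ ((nakLProj M X).lin n)).symm)
  exact (Category.assoc _ _ _).symm.trans
    (congrArg (· ≫ g) (slice_nakLProj M X φ n).symm)

variable (k) in
/-- Every pair of elements of `C` lies in a common finite-dimensional subcomodule. -/
lemma exists_fdComod_map_regular (c c' : C) :
    ∃ (X : FdComod k C) (g : X.obj ⟶ Comod.regular k C) (x x' : X.obj.carrier),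
      g.lin x = c ∧ g.lin x' = c' := by
  obtain ⟨S, hfin, hS, hc⟩ := Comod.exists_finite_stable (Comod.regular k C) c
  obtain ⟨S', hfin', hS', hc'⟩ := Comod.exists_finite_stable (Comod.regular k C) c'
  have h := Comod.stable_sup hS hS'
  exact ⟨⟨(Comod.regular k C).sub (S ⊔ S') h, Submodule.finite_sup S S'⟩, Comod.subι _ _ h,
    ⟨c, Submodule.mem_sup_left hc⟩, ⟨c', Submodule.mem_sup_right hc'⟩, rfl, rfl⟩

/-- Two morphisms from finite-dimensional comodules to `C` factor through a common
finite-dimensional subcomodule. -/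
lemma exists_fdComod_factor {X Y : FdComod k C} (g : X.obj ⟶ Comod.regular k C)
    (h : Y.obj ⟶ Comod.regular k C) :
    ∃ (Z : FdComod k C) (j : Z.obj ⟶ Comod.regular k C) (_ : Function.Injective j.lin)
      (g' : X ⟶ Z) (h' : Y ⟶ Z), g'.hom ≫ j = g ∧ h'.hom ≫ j = h := by
  have hS := Comod.stable_sup (Comod.stable_range g) (Comod.stable_range h)
  exact ⟨⟨(Comod.regular k C).sub _ hS, Submodule.finite_sup _ _⟩,
    Comod.subι _ _ hS, Subtype.val_injective,
    ObjectProperty.homMk (Comod.subLift _ _ hS g fun x => Submodule.mem_sup_left ⟨x, rfl⟩),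
    ObjectProperty.homMk (Comod.subLift _ _ hS h fun y => Submodule.mem_sup_right ⟨y, rfl⟩),
    rfl, rfl⟩

section Lift

variable {M E : Comod k C} (π : ∀ X : FdComod k C, E ⟶ tens (homSpace X.obj M) X.obj)
  (hπ : ∀ ⦃X Y : FdComod k C⦄ (g : X ⟶ Y),
    π X ≫ ((Comod.copower k C).obj _).map g.hom =
      π Y ≫ ((Comod.copower k C).map (precomp g.hom M)).app Y.obj)

/-- For a wedge `π` and `g : X → C`, the morphism `X → M` which is the slice of `π_X(e)` along
the functional `ε ∘ g`. For the universal wedge and `e = ξ` it is `ξ ∘ g`. -/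
def wedgeSlice {X : FdComod k C} (g : X.obj ⟶ Comod.regular k C) (e : E.carrier) : X.obj ⟶ M :=
  slice (X.obj ⟶ M) (counitComp g) ((π X).lin e)

include hπ in
lemma wedgeSlice_comp {X Y : FdComod k C} (h : X ⟶ Y) (g : Y.obj ⟶ Comod.regular k C)
    (e : E.carrier) : wedgeSlice π (h.hom ≫ g) e = h.hom ≫ wedgeSlice π g e :=
  slice_wedge (π := π) h (hπ h) (counitComp g) e

/-- The action of `f` on `e` corresponds to the endomorphism `c ↦ c ↼ f` of `C`, as
`ε(c ↼ f) = f(c)`. -/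
lemma wedgeSlice_act {X : FdComod k C} (g : X.obj ⟶ Comod.regular k C) (f : C →ₗ[k] k)
    (e : E.carrier) : wedgeSlice π g (E.act f e) = wedgeSlice π (g ≫ rightActHom f) e := by
  have h : counitComp (g ≫ rightActHom f) = dualAct X.obj f (counitComp g) := by
    rw [← counitComp_coeff (dualAct X.obj f (counitComp g)), ← coeff_comp_rightActHom,
      coeff_counitComp]
  have h' := congrArg (slice (X.obj ⟶ M) (counitComp g))
    ((Comod.lin_act (π X) f e).trans (Comod.copowerObj_act _ _ f _))
  refine h'.trans ((slice_lTensor_act X.obj f _ _).trans ?_)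
  exact congrArg (fun φ => slice (X.obj ⟶ M) φ ((π X).lin e)) h.symm

include hπ in
/-- The value of `wedgeSlice π g e` at `x` depends on `g(x) ∈ C` only. -/
lemma wedgeSlice_congr {X Y : FdComod k C} (g : X.obj ⟶ Comod.regular k C)
    (h : Y.obj ⟶ Comod.regular k C) (e : E.carrier) (x : X.obj.carrier) (y : Y.obj.carrier)
    (hxy : g.lin x = h.lin y) : (wedgeSlice π g e).lin x = (wedgeSlice π h e).lin y := by
  obtain ⟨Z, j, hj, g', h', rfl, rfl⟩ := exists_fdComod_factor g h
  rw [wedgeSlice_comp π hπ, wedgeSlice_comp π hπ, Comod.comp_lin, Comod.comp_lin,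
    LinearMap.comp_apply, LinearMap.comp_apply, hj hxy]

include hπ in
/-- The morphisms `wedgeSlice π g e` glue to a morphism `C → M`. -/
lemma exists_glue (e : E.carrier) : ∃ ξ : Comod.regular k C ⟶ M,
    ∀ (X : FdComod k C) (g : X.obj ⟶ Comod.regular k C), wedgeSlice π g e = g ≫ ξ := by
  have hval (c : C) : ∃ m : M.carrier, ∀ (X : FdComod k C) (g : X.obj ⟶ Comod.regular k C)
      (x : X.obj.carrier), g.lin x = c → (wedgeSlice π g e).lin x = m := by
    obtain ⟨X, g, x, -, rfl, -⟩ := exists_fdComod_map_regular k c c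
    exact ⟨_, fun Y h y hy => wedgeSlice_congr π hπ h g e y x hy⟩
  choose v hv using hval
  let ξ : C →ₗ[k] M.carrier :=
    { toFun := v
      map_add' := fun c c' => by
        obtain ⟨X, g, x, x', hx, hx'⟩ := exists_fdComod_map_regular k c c'
        rw [← hv c X g x hx, ← hv c' X g x' hx', ← map_add]
        exact (hv _ X g _ ((map_add g.lin x x').trans (congrArg₂ _ hx hx'))).symm
      map_smul' := fun a c => by
        obtain ⟨X, g, x, -, hx, -⟩ := exists_fdComod_map_regular k c c
        rw [← hv c X g x hx, RingHom.id_apply, ← map_smul]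
        exact (hv _ X g _ ((map_smul g.lin a x).trans (congrArg (a • ·) hx))).symm }
  refine ⟨Comod.homOfAct (M := Comod.regular k C) ξ fun f c => ?_, fun X g => ?_⟩
  · obtain ⟨X, g, x, -, rfl, -⟩ := exists_fdComod_map_regular k c c
    change v _ = M.act f (v _)
    rw [← hv _ X g x rfl]
    exact (hv _ X g _ (Comod.lin_act g f x)).symm.trans
      (Comod.lin_act (wedgeSlice π g e) f x)
  · ext x
    exact hv _ X g x rfl

include hπ in
/-- Every wedge factors through the universal one: the morphisms glued from the slices of `π` at
`e` depend `C*`-linearly on `e`, so they lie in the rational part. -/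
lemma exists_nakL_lift : ∃ u : E ⟶ (nakL k C).obj M, ∀ X : FdComod k C,
    u ≫ nakLProj M X.obj = π X := by
  choose ξ hξ using exists_glue π hπ
  have hext {η η' : Comod.regular k C ⟶ M}
      (h : ∀ (X : FdComod k C) (g : X.obj ⟶ Comod.regular k C), g ≫ η = g ≫ η') : η = η' := by
    ext c
    obtain ⟨X, g, x, -, rfl, -⟩ := exists_fdComod_map_regular k c c
    exact congrArg (fun l : X.obj ⟶ M => l.lin x) (h X g)
  let u : E.carrier →ₗ[k] (Comod.regular k C ⟶ M) :=
    { toFun := ξ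
      map_add' := fun e e' => hext fun X g => by
        rw [Preadditive.comp_add, ← hξ, ← hξ, ← hξ]
        exact (congrArg (slice (X.obj ⟶ M) (counitComp g)) (map_add (π X).lin e e')).trans
          (map_add _ _ _)
      map_smul' := fun a e => hext fun X g => by
        rw [RingHom.id_apply, Linear.comp_smul, ← hξ, ← hξ]
        exact (congrArg (slice (X.obj ⟶ M) (counitComp g)) (map_smul (π X).lin a e)).trans
          (map_smul _ _ _) }
  have hu (f : C →ₗ[k] k) (e : E.carrier) : u (E.act f e) = WithConv.toConv f • u e :=
    hext fun X g => by
      rw [smul_regularHom, ← Category.assoc]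
      exact (hξ _ X g).symm.trans ((wedgeSlice_act π g f e).trans (hξ e X _))
  let u' : E.carrier →ₗ[k] ratPart k C (Comod.regular k C ⟶ M) :=
    u.codRestrict ((ratPart k C (Comod.regular k C ⟶ M)).restrictScalars k)
      (mem_ratPart_of_comod k C _ E u hu)
  refine ⟨Comod.homOfAct (N := (nakL k C).obj M) u' fun f e => ?_, fun X => ?_⟩
  · exact Subtype.ext ((hu f e).trans (coe_nakL_act M f (u' e)).symm)
  · ext e
    refine slice_ext (N := X.obj ⟶ M) fun φ => ?_
    refine (slice_nakLProj M X.obj φ (u' e)).trans ((hξ e X (coeff φ)).symm.trans ?_)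
    rw [wedgeSlice, counitComp_coeff]

end Lift

lemma nakL_hom_ext {M E : Comod k C} {u v : E ⟶ (nakL k C).obj M}
    (h : ∀ X : FdComod k C, u ≫ nakLProj M X.obj = v ≫ nakLProj M X.obj) : u = v := by
  ext e
  refine Subtype.ext (Comod.hom_ext (LinearMap.ext fun c => ?_))
  obtain ⟨X, g, x, -, rfl, -⟩ := exists_fdComod_map_regular k c c
  have h1 := congrArg (fun l : E ⟶ tens (homSpace X.obj M) X.obj =>
    slice (X.obj ⟶ M) (counitComp g) (l.lin e)) (h X)
  have h2 := (slice_nakLProj M X.obj _ (u.lin e)).symm.trans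
    (h1.trans (slice_nakLProj M X.obj _ (v.lin e)))
  rw [coeff_counitComp] at h2
  exact congrArg (fun l : X.obj ⟶ M => l.lin x) h2

/-- The universal wedge `Hom^C(C, M)^rat → Hom^C(X, M) ⊗ X`. -/
def nakLWedge (M : Comod k C) : Wedge (integrandL M) :=
  Wedge.mk ((nakL k C).obj M) (fun X => nakLProj M X.obj) (nakLProj_wedge M)

/-- The wedge `nakLWedge M` is an end. -/
def nakLWedgeIsLimit (M : Comod k C) : IsLimit (nakLWedge M) :=
  Multifork.IsLimit.mk _
    (fun E => (exists_nakL_lift (E := E.pt) E.ι fun _ _ g => Wedge.condition E g).choose)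
    (fun E => (exists_nakL_lift (E := E.pt) E.ι fun _ _ g => Wedge.condition E g).choose_spec)
    (fun E _ hu => nakL_hom_ext fun X => (hu X).trans
      ((exists_nakL_lift (E := E.pt) E.ι fun _ _ g => Wedge.condition E g).choose_spec X).symm)

end LeftEnd

/-! ### The adjunction between the two Nakayama functors -/

section Adjunction

variable {M N : Comod k C}

/-- The morphism `c ↦ h(c ⊗ m)`. -/
def nakRHomApply (h : (nakR k C).obj M ⟶ N) (m : M.carrier) : Comod.regular k C ⟶ N :=
  Comod.homOfAct (M := Comod.regular k C)
    ((h.lin : NakRSpace M →ₗ[k] N.carrier) ∘ₗ (balancedRel rightAct M.act).mkQ ∘ₗ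
      (TensorProduct.mk k C M.carrier).flip m) fun f c =>
    (congrArg h.lin (slice_nakRCoact M f c m).symm).trans (Comod.lin_act h f _)

lemma nakRHomApply_act (h : (nakR k C).obj M ⟶ N) (f : C →ₗ[k] k) (m : M.carrier) :
    nakRHomApply h (M.act f m) = rightActHom f ≫ nakRHomApply h m := by
  ext c
  exact congrArg h.lin (mk_balanced rightAct M.act f c m).symm

/-- The morphism `C ⊗_{C*} M → N` is curried to a morphism `M → Hom^C(C, N)^rat`. -/
def nakRCurry (h : (nakR k C).obj M ⟶ N) : M ⟶ (nakL k C).obj N :=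
  let u : M.carrier →ₗ[k] (Comod.regular k C ⟶ N) :=
    { toFun := nakRHomApply h
      map_add' := fun m m' => Comod.hom_ext (LinearMap.ext fun c =>
        (congrArg (fun t => h.lin ((balancedRel rightAct M.act).mkQ t))
          (tmul_add c m m')).trans ((congrArg h.lin (map_add _ _ _)).trans (map_add h.lin _ _)))
      map_smul' := fun a m => Comod.hom_ext (LinearMap.ext fun c =>
        (congrArg (fun t => h.lin ((balancedRel rightAct M.act).mkQ t))
          (tmul_smul a c m)).trans ((congrArg h.lin (map_smul _ _ _)).trans (map_smul h.lin _ _))) }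
  let u' : M.carrier →ₗ[k] ratPart k C (Comod.regular k C ⟶ N) :=
    u.codRestrict ((ratPart k C (Comod.regular k C ⟶ N)).restrictScalars k)
      (mem_ratPart_of_comod k C _ M u (nakRHomApply_act h))
  Comod.homOfAct (N := (nakL k C).obj N) u' fun f m =>
    Subtype.ext ((nakRHomApply_act h f m).trans (coe_nakL_act N f (u' m)).symm)

/-- The underlying map of a morphism into `Hom^C(C, N)^rat`, as a bilinear map. -/
def nakLHomLin (v : M ⟶ (nakL k C).obj N) : M.carrier →ₗ[k] C →ₗ[k] N.carrier :=
  { toFun := fun ξ => ξ.lin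
    map_add' := fun _ _ => rfl
    map_smul' := fun _ _ => rfl : (Comod.regular k C ⟶ N) →ₗ[k] (C →ₗ[k] N.carrier) } ∘ₗ
  ((ratPart k C (Comod.regular k C ⟶ N)).restrictScalars k).subtype ∘ₗ v.lin

lemma nakLHomLin_act (v : M ⟶ (nakL k C).obj N) (f : C →ₗ[k] k) (m : M.carrier) (c : C) :
    nakLHomLin v (M.act f m) c = nakLHomLin v m (rightAct f c) := by
  have h := (congrArg Subtype.val (Comod.lin_act v f m)).trans (coe_nakL_act N f (v.lin m))
  exact congrArg (fun l : Comod.regular k C ⟶ N => l.lin c) h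

/-- The morphism `C ⊗_{C*} M → N`, `c ⊗ m ↦ v(m)(c)`. -/
def nakRUncurry (v : M ⟶ (nakL k C).obj N) : (nakR k C).obj M ⟶ N :=
  let g : NakRSpace M →ₗ[k] N.carrier := (balancedRel rightAct M.act).liftQ
    (TensorProduct.lift (nakLHomLin v).flip) (balancedRel_le_ker _ fun f c m =>
      (nakLHomLin_act v f m c).symm)
  Comod.homOfAct (M := (nakR k C).obj M) g fun f t => by
    refine LinearMap.congr_fun (f := g ∘ₗ slice _ f ∘ₗ nakRCoact M) (g := N.act f ∘ₗ g)
      (balanced_induction fun c m => ?_) t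
    refine (congrArg g (slice_nakRCoact M f c m)).trans ?_
    exact Comod.lin_act (M := Comod.regular k C) (v.lin m).1 f c

variable (k C)

/-- The right exact Nakayama functor is left adjoint to the left exact one: this is the
tensor-hom adjunction over `C*`, as a `C*`-linear map from a comodule into a `C*`-module takes
values in the rational part. -/
def nakAdjunction : nakR k C ⊣ nakL k C :=
  Adjunction.mkOfHomEquiv
    { homEquiv := fun M N =>
        { toFun := nakRCurry
          invFun := nakRUncurry
          left_inv := fun h => Comod.hom_ext (balanced_induction fun c m => rfl)
          right_inv := fun v => rfl }
      homEquiv_naturality_left_symm := fun {M' M N} g v =>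
        Comod.hom_ext (balanced_induction fun c m => rfl)
      homEquiv_naturality_right := fun h g => by rfl }

end Adjunction

/-! ### The universal property of copowers -/

section Copower

variable {W : ModuleCat.{u} k} {X Z : Comod k C}

/-- The morphisms `x ↦ w ⊗ x`, linearly in `w`. -/
def copowerIns (W : ModuleCat.{u} k) (X : Comod k C) :
    W →ₗ[k] (X ⟶ tens W X) where
  toFun w := Comod.homOfAct (N := Comod.copowerObj W X) (TensorProduct.mk k W X.carrier w)
    fun f x => by rw [Comod.copowerObj_act]; rfl
  map_add' w w' := Comod.hom_ext (LinearMap.ext fun x => add_tmul w w' x)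
  map_smul' a w := Comod.hom_ext (LinearMap.ext fun x => (smul_tmul' a w x).symm)

/-- The morphism `W ⊗ X → Z` given by a linear map `W → Hom^C(X, Z)`. -/
def copowerDesc (a : W →ₗ[k] (X ⟶ Z)) : tens W X ⟶ Z :=
  let l : (X ⟶ Z) →ₗ[k] (X.carrier →ₗ[k] Z.carrier) :=
    { toFun := fun ξ => ξ.lin
      map_add' := fun _ _ => rfl
      map_smul' := fun _ _ => rfl }
  Comod.homOfAct (M := Comod.copowerObj W X) (TensorProduct.lift (l ∘ₗ a)) fun f t => by
    rw [Comod.copowerObj_act]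
    induction t using TensorProduct.induction_on with
    | zero => simp
    | add x y hx hy => simp only [map_add, hx, hy]
    | tmul w x => exact Comod.lin_act (a w) f x

lemma copowerIns_desc (a : W →ₗ[k] (X ⟶ Z)) (w : W) :
    copowerIns W X w ≫ copowerDesc a = a w := rfl

lemma copower_hom_ext {f g : tens W X ⟶ Z}
    (h : ∀ w, copowerIns W X w ≫ f = copowerIns W X w ≫ g) : f = g :=
  Comod.hom_ext (TensorProduct.ext' fun w x =>
    congrArg (fun l : X ⟶ Z => l.lin x) (h w))

lemma copowerIns_map {W' : ModuleCat.{u} k} (a : W ⟶ W') (w : W) :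
    copowerIns W X w ≫ ((Comod.copower k C).map a).app X = copowerIns W' X (a.hom w) := rfl

lemma copowerIns_map_right (g : X ⟶ Z) (w : W) :
    copowerIns W X w ≫ ((Comod.copower k C).obj W).map g = g ≫ copowerIns W Z w := rfl

/-- A morphism `W ⊗ X → Z` as a linear map `W → Hom^C(X, Z)`. -/
def copowerCurry (f : tens W X ⟶ Z) :
    W ⟶ homSpace X Z :=
  ModuleCat.ofHom (Linear.rightComp k X f ∘ₗ copowerIns W X)

end Copower

/-! ### The right exact Nakayama functor as a coend -/

section RightEnd

variable {M E : Comod k C} {X Y : FdComod k C}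

/-- Morphisms `coHom^C(X, M) ⊗ X → E` correspond to morphisms `M → Hom^C(X, E) ⊗ X`. -/
def coHomCopowerEquiv (M E : Comod k C) (X : FdComod k C) :
    (tens (coHom X.obj M) X.obj ⟶ E) ≃
      (M ⟶ tens (homSpace X.obj E) X.obj) where
  toFun κ := coHomEquiv X.obj M _ (copowerCurry κ)
  invFun b := copowerDesc ((coHomEquiv X.obj M _).symm b).hom
  left_inv κ := copower_hom_ext fun w =>
    congrArg (fun l : coHom X.obj M ⟶ homSpace X.obj E => l.hom w)
      (Equiv.symm_apply_apply (coHomEquiv X.obj M _) (copowerCurry κ))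
  right_inv b := Equiv.apply_symm_apply (coHomEquiv X.obj M _) b

lemma coHomCopowerEquiv_comp {E' : Comod k C}
    (κ : tens (coHom X.obj M) X.obj ⟶ E) (h : E ⟶ E') :
    coHomCopowerEquiv M E' X (κ ≫ h) = coHomCopowerEquiv M E X κ ≫
      ((Comod.copower k C).map (postcomp X.obj h)).app X.obj :=
  coHomEquiv_comp X.obj M (copowerCurry κ) (postcomp X.obj h)

/-- The map `coHom^C(Y, M) → coHom^C(X, M)` given by `g : X → Y`. -/
def coHomMap (M : Comod k C) (g : X ⟶ Y) : coHom Y.obj M ⟶ coHom X.obj M := (coHomFd M).map g.op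

lemma coHomEquiv_coHomMap_comp {W : ModuleCat.{u} k} (g : X ⟶ Y) (a : coHom X.obj M ⟶ W) :
    coHomEquiv Y.obj M W (coHomMap M g ≫ a) =
      coHomEquiv X.obj M W a ≫ ((Comod.copower k C).obj W).map g.hom := by
  have h := coHomEquiv_comp X.obj M (𝟙 _) a
  rw [Category.id_comp] at h
  have h' : coHomEquiv Y.obj M _ (coHomMap M g) =
      coHomEquiv X.obj M _ (𝟙 _) ≫ ((Comod.copower k C).obj _).map g.hom :=
    Equiv.apply_symm_apply _ _
  rw [coHomEquiv_comp, h', h, Category.assoc, Category.assoc, NatTrans.naturality]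

/-- Under `coHomCopowerEquiv`, the cowedges from `integrandR M` to `E` are the wedges from `M` to
`integrandL E`. -/
lemma cowedge_condition_iff (g : X ⟶ Y) (κ : tens (coHom X.obj M) X.obj ⟶ E)
    (κ' : tens (coHom Y.obj M) Y.obj ⟶ E) :
    ((Comod.copower k C).map (coHomMap M g)).app X.obj ≫ κ =
        ((Comod.copower k C).obj (coHom Y.obj M)).map g.hom ≫ κ' ↔
      coHomCopowerEquiv M E X κ ≫ ((Comod.copower k C).obj _).map g.hom =
        coHomCopowerEquiv M E Y κ' ≫ ((Comod.copower k C).map (precomp g.hom E)).app Y.obj := by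
  have e1 : coHomCopowerEquiv M E X κ ≫ ((Comod.copower k C).obj _).map g.hom =
      coHomEquiv Y.obj M _ (coHomMap M g ≫ copowerCurry κ) :=
    (coHomEquiv_coHomMap_comp g (copowerCurry κ)).symm
  have e2 : coHomCopowerEquiv M E Y κ' ≫
      ((Comod.copower k C).map (precomp g.hom E)).app Y.obj =
      coHomEquiv Y.obj M _ (copowerCurry κ' ≫ precomp g.hom E) :=
    (coHomEquiv_comp Y.obj M _ _).symm
  refine Iff.trans ?_ ((Eq.congr e1 e2).trans (coHomEquiv Y.obj M _).injective.eq_iff).symm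
  constructor
  · intro h
    ext w : 2
    exact congrArg (copowerIns (coHom Y.obj M) X.obj w ≫ ·) h
  · intro h
    refine copower_hom_ext fun w => ?_
    exact congrArg (fun l : coHom Y.obj M ⟶ homSpace X.obj E => l.hom w) h

/-- The component `coHom^C(X, M) ⊗ X → C ⊗_{C*} M` of the universal cowedge. -/
def nakRIncl (M : Comod k C) (X : FdComod k C) :
    tens (coHom X.obj M) X.obj ⟶ (nakR k C).obj M :=
  (coHomCopowerEquiv M _ X).symm
    ((nakAdjunction k C).unit.app M ≫ nakLProj ((nakR k C).obj M) X.obj)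

lemma coHomCopowerEquiv_nakRIncl_comp (h : (nakR k C).obj M ⟶ E) :
    coHomCopowerEquiv M E X (nakRIncl M X ≫ h) =
      (nakAdjunction k C).homEquiv M E h ≫ nakLProj E X.obj := by
  rw [coHomCopowerEquiv_comp, nakRIncl, Equiv.apply_symm_apply, Adjunction.homEquiv_unit,
    Category.assoc]
  exact (congrArg ((nakAdjunction k C).unit.app M ≫ ·) (nakL_map_nakLProj h X.obj).symm).trans
    (Category.assoc _ _ _).symm

lemma nakRIncl_cowedge (M : Comod k C) ⦃X Y : FdComod k C⦄ (g : X ⟶ Y) :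
    ((Comod.copower k C).map (coHomMap M g)).app X.obj ≫ nakRIncl M X =
      ((Comod.copower k C).obj (coHom Y.obj M)).map g.hom ≫ nakRIncl M Y := by
  rw [cowedge_condition_iff, nakRIncl, nakRIncl, Equiv.apply_symm_apply, Equiv.apply_symm_apply]
  exact congrArg ((nakAdjunction k C).unit.app M ≫ ·) (nakLProj_wedge _ g)

lemma nakR_hom_ext {h h' : (nakR k C).obj M ⟶ E}
    (H : ∀ X : FdComod k C, nakRIncl M X ≫ h = nakRIncl M X ≫ h') : h = h' := by
  apply ((nakAdjunction k C).homEquiv M E).injective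
  refine nakL_hom_ext fun X => ?_
  rw [← coHomCopowerEquiv_nakRIncl_comp, H, coHomCopowerEquiv_nakRIncl_comp]

lemma exists_nakR_desc
    (κ : ∀ X : FdComod k C, tens (coHom X.obj M) X.obj ⟶ E)
    (hκ : ∀ ⦃X Y : FdComod k C⦄ (g : X ⟶ Y),
      ((Comod.copower k C).map (coHomMap M g)).app X.obj ≫ κ X =
      ((Comod.copower k C).obj (coHom Y.obj M)).map g.hom ≫ κ Y) :
    ∃ h : (nakR k C).obj M ⟶ E, ∀ X, nakRIncl M X ≫ h = κ X := by
  obtain ⟨u, hu⟩ := exists_nakL_lift (fun X => coHomCopowerEquiv M E X (κ X))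
    fun X Y g => (cowedge_condition_iff g _ _).1 (hκ g)
  refine ⟨((nakAdjunction k C).homEquiv M E).symm u, fun X => ?_⟩
  apply (coHomCopowerEquiv M E X).injective
  rw [coHomCopowerEquiv_nakRIncl_comp, Equiv.apply_symm_apply]
  exact hu X

/-- The comodule `C ⊗_{C*} M` is a coend: by the adjunction with the left exact Nakayama functor,
the morphisms out of it are the wedges from `M` to `integrandL E`, hence the cowedges from
`integrandR M` to `E`. -/
lemma isCoend_nakR (M : Comod k C) : IsCoend (integrandR M) ((nakR k C).obj M) := by
  choose d hd using fun E : Cowedge (integrandR M) =>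
    exists_nakR_desc (E := E.pt) E.π fun _ _ g => Cowedge.condition E g
  exact ⟨nakRIncl M, nakRIncl_cowedge M, ⟨Multicofork.IsColimit.mk _ d hd fun E _ h =>
    nakR_hom_ext fun X => (h X).trans (hd E X).symm⟩⟩

lemma isEnd_nakL (M : Comod k C) : IsEnd (integrandL M) ((nakL k C).obj M) :=
  ⟨fun X => nakLProj M X.obj, nakLProj_wedge M, ⟨nakLWedgeIsLimit M⟩⟩

end RightEnd

/-! ### Finite-dimensional comodules and copowers -/

section Finite

/-- The morphism `W ⊗ X → W' ⊗ X` given by a linear map `W → W'`. -/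
abbrev tensL {W W' : ModuleCat.{u} k} (a : W ⟶ W') (X : Comod k C) : tens W X ⟶ tens W' X :=
  ((Comod.copower k C).map a).app X

/-- The morphism `W ⊗ X → W ⊗ Y` given by a morphism `X → Y`. -/
abbrev tensR (W : ModuleCat.{u} k) {X Y : Comod k C} (g : X ⟶ Y) : tens W X ⟶ tens W Y :=
  ((Comod.copower k C).obj W).map g

lemma tensL_tensR {W W' : ModuleCat.{u} k} (a : W ⟶ W') {X Y : Comod k C} (g : X ⟶ Y) :
    tensL a X ≫ tensR W' g = tensR W g ≫ tensL a Y :=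
  (((Comod.copower k C).map a).naturality g).symm

lemma tensL_comp {W W' W'' : ModuleCat.{u} k} (a : W ⟶ W') (b : W' ⟶ W'') (X : Comod k C) :
    tensL (a ≫ b) X = tensL a X ≫ tensL b X := by
  rw [tensL, Functor.map_comp, NatTrans.comp_app]

/-- A morphism from a finite-dimensional comodule to `W ⊗ Z` is a finite sum of morphisms
`x ↦ w ⊗ g(x)`. -/
lemma exists_eq_sum_comp_copowerIns {X Z : Comod k C} [Module.Finite k X.carrier]
    {W : ModuleCat.{u} k} (f : X ⟶ tens W Z) :
    ∃ (n : ℕ) (w : Fin n → W) (g : Fin n → (X ⟶ Z)), f = ∑ i, g i ≫ copowerIns W Z (w i) := by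
  let b := Module.finBasis k X.carrier
  obtain ⟨W', hfin, hW'⟩ := TensorProduct.exists_finite_submodule_left_of_setFinite
    (M := W) (N := Z.carrier) (Set.range fun i => f.lin (b i)) (Set.finite_range _)
  obtain ⟨r, hr⟩ := W'.subtype.exists_leftInverse_of_injective
    (LinearMap.ker_eq_bot.2 W'.injective_subtype)
  let b' := Module.finBasis k W'
  -- The map `W'.subtype ∘ r` is a projection onto `W'`, so `p` fixes the image of `f`; a basis of
  -- `W'` writes `p` as a finite sum of morphisms which factor through `Z`.
  let p : tens W Z ⟶ tens W Z := tensL (ModuleCat.ofHom (W'.subtype ∘ₗ r)) Z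
  let a (i) : W →ₗ[k] (Z ⟶ Z) := (LinearMap.toSpanSingleton k (Z ⟶ Z) (𝟙 Z)) ∘ₗ b'.coord i ∘ₗ r
  have hp : p = ∑ i, copowerDesc (a i) ≫ copowerIns W Z (b' i) := by
    refine copower_hom_ext fun w => ?_
    rw [Preadditive.comp_sum]
    have h (i) : copowerIns W Z w ≫ copowerDesc (a i) ≫ copowerIns W Z (b' i) =
        b'.coord i (r w) • copowerIns W Z (b' i) := by
      rw [← Category.assoc, copowerIns_desc]
      change (b'.coord i (r w) • 𝟙 Z) ≫ _ = _
      rw [Linear.smul_comp, Category.id_comp]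
    simp only [h]
    refine (copowerIns_map _ w).trans ?_
    refine (congrArg (copowerIns W Z ∘ₗ W'.subtype) (b'.sum_repr (r w)).symm).trans ?_
    rw [map_sum]
    exact Finset.sum_congr rfl fun i _ => map_smul (copowerIns W Z ∘ₗ W'.subtype) _ _
  have hf : f = f ≫ p := by
    refine Comod.hom_ext (b.ext fun i => ?_)
    obtain ⟨t, ht⟩ := hW' ⟨i, rfl⟩
    change f.lin (b i) = (W'.subtype ∘ₗ r).rTensor Z.carrier (f.lin (b i))
    refine ht.symm.trans (Eq.trans ?_ (congrArg ((W'.subtype ∘ₗ r).rTensor Z.carrier) ht))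
    rw [← LinearMap.comp_apply, ← LinearMap.rTensor_comp, LinearMap.comp_assoc, hr,
      LinearMap.comp_id]
  refine ⟨_, fun i => b' i, fun i => f ≫ copowerDesc (a i), ?_⟩
  refine hf.trans ?_
  rw [hp, Preadditive.comp_sum]
  simp only [Category.assoc]

/-- The coaction of `Y`, as a morphism to the cofree comodule `Y ⊗ C`. -/
def coactHom (Y : Comod k C) :
    Y ⟶ tens (ModuleCat.of k Y.carrier) (Comod.regular k C) :=
  Comod.homOfAct (N := Comod.copowerObj Y.carrier (Comod.regular k C)) Y.coact fun f y =>
    slice_ext (N := Y.carrier) fun φ => by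
      rw [Comod.copowerObj_act, slice_lTensor, ← Comod.act_apply, Comod.act_act, Comod.act_apply]
      congr 2
      ext c
      exact (apply_leftAct f φ c).symm

/-- If the coaction `Y → Y ⊗ C` is a finite sum of morphisms `y ↦ yᵢ ⊗ hᵢ(y)`, then the `yᵢ` span
`Y`, as `y = ∑ ε(hᵢ(y)) yᵢ`. -/
lemma finite_of_coactHom_eq_sum (Y : Comod k C) {n : ℕ} (w : Fin n → Y.carrier)
    (h : Fin n → (Y ⟶ Comod.regular k C))
    (H : coactHom Y = ∑ i, h i ≫ copowerIns (ModuleCat.of k Y.carrier) _ (w i)) :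
    Module.Finite k Y.carrier := by
  refine ⟨Submodule.fg_def.2 ⟨Set.range w, Set.finite_range w, ?_⟩⟩
  refine Submodule.eq_top_iff'.2 fun y => ?_
  have h1 : slice Y.carrier (Coalgebra.counit (R := k)) ((coactHom Y).lin y) = y := Y.act_counit y
  have h2 := congrArg (fun l : Y ⟶ tens (ModuleCat.of k Y.carrier) (Comod.regular k C) =>
    slice Y.carrier (Coalgebra.counit (R := k)) (l.lin y)) H
  let l : (Y ⟶ tens (ModuleCat.of k Y.carrier) (Comod.regular k C)) →ₗ[k] Y.carrier :=
    { toFun := fun l => slice Y.carrier (Coalgebra.counit (R := k)) (l.lin y)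
      map_add' := fun l l' => map_add (slice Y.carrier (Coalgebra.counit (R := k) (A := C))) _ _
      map_smul' := fun a l => map_smul (slice Y.carrier (Coalgebra.counit (R := k) (A := C))) _ _ }
  have h3 := h1.symm.trans (h2.trans (map_sum l _ _))
  rw [h3]
  refine Submodule.sum_mem _ fun i _ => ?_
  have h4 : l (h i ≫ copowerIns (ModuleCat.of k Y.carrier) _ (w i)) =
      Coalgebra.counit (R := k) (A := C) ((h i).lin y) • w i := slice_tmul _ _ _
  rw [h4]
  exact Submodule.smul_mem _ _ (Submodule.subset_span ⟨i, rfl⟩)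

end Finite

/-! ### Equivalences of comodule categories -/

section Equivalence

variable {D : Type u} [AddCommGroup D] [Module k D] [Coalgebra k D]
  (Φ : Comod k C ⥤ Comod k D) [Φ.Additive] [Functor.Linear k Φ]

/-- The comparison morphism `W ⊗ Φ X → Φ (W ⊗ X)`. -/
def tensComparison (W : ModuleCat.{u} k) (X : Comod k C) :
    tens W (Φ.obj X) ⟶ Φ.obj (tens W X) :=
  copowerDesc (Φ.mapLinearMap k ∘ₗ copowerIns W X)

lemma copowerIns_tensComparison {W : ModuleCat.{u} k} {X : Comod k C} (w : W) :
    copowerIns W (Φ.obj X) w ≫ tensComparison Φ W X = Φ.map (copowerIns W X w) := rfl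

lemma tensComparison_naturality_left {W W' : ModuleCat.{u} k} (a : W ⟶ W') (X : Comod k C) :
    tensL a (Φ.obj X) ≫ tensComparison Φ W' X = tensComparison Φ W X ≫ Φ.map (tensL a X) :=
  copower_hom_ext fun w => by
    rw [← Category.assoc, ← Category.assoc, copowerIns_map, copowerIns_tensComparison,
      copowerIns_tensComparison, ← Φ.map_comp, copowerIns_map]

lemma tensComparison_naturality_right (W : ModuleCat.{u} k) {X Y : Comod k C} (g : X ⟶ Y) :
    tensR W (Φ.map g) ≫ tensComparison Φ W Y = tensComparison Φ W X ≫ Φ.map (tensR W g) :=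
  copower_hom_ext fun w => by
    rw [← Category.assoc, ← Category.assoc, copowerIns_map_right, copowerIns_tensComparison,
      ← Φ.map_comp, copowerIns_map_right, Category.assoc, copowerIns_tensComparison, Φ.map_comp]

variable [Φ.IsEquivalence]

/-- The linear bijection `Hom^C(X, Y) → Hom^D(Φ X, Φ Y)`. -/
def mapHomEquiv (X Y : Comod k C) : (X ⟶ Y) ≃ₗ[k] (Φ.obj X ⟶ Φ.obj Y) :=
  LinearEquiv.ofBijective (Φ.mapLinearMap k) ⟨Φ.map_injective, Φ.map_surjective⟩

lemma map_mapHomEquiv_symm {X Y : Comod k C} (g : Φ.obj X ⟶ Φ.obj Y) :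
    Φ.map ((mapHomEquiv Φ X Y).symm g) = g :=
  (mapHomEquiv Φ X Y).apply_symm_apply g

/-- Both `W ⊗ Φ X` and `Φ (W ⊗ X)` represent `Z ↦ Hom_k(W, Hom^D(Φ X, Z))`. -/
instance isIso_tensComparison (W : ModuleCat.{u} k) (X : Comod k C) :
    IsIso (tensComparison Φ W X) := by
  let i := Φ.objObjPreimageIso (tens W (Φ.obj X))
  let d : tens W X ⟶ Φ.objPreimage (tens W (Φ.obj X)) :=
    copowerDesc ((mapHomEquiv Φ _ _).symm.toLinearMap ∘ₗ Linear.rightComp k _ i.inv ∘ₗ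
      copowerIns W (Φ.obj X))
  have hd (w : W) : Φ.map (copowerIns W X w) ≫ Φ.map d = copowerIns W (Φ.obj X) w ≫ i.inv := by
    rw [← Φ.map_comp, copowerIns_desc]
    exact map_mapHomEquiv_symm Φ _
  refine ⟨Φ.map d ≫ i.hom, copower_hom_ext fun w => ?_, ?_⟩
  · rw [← Category.assoc, copowerIns_tensComparison, ← Category.assoc, hd, Category.assoc,
      i.inv_hom_id, Category.comp_id]
  · obtain ⟨h, hh⟩ := Φ.map_surjective (i.hom ≫ tensComparison Φ W X)
    rw [Category.assoc, ← hh, ← Φ.map_comp, ← Φ.map_id]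
    congr 1
    refine copower_hom_ext fun w => Φ.map_injective ?_
    rw [← Category.assoc, Φ.map_comp, Φ.map_comp, hd, hh, Category.assoc, i.inv_hom_id_assoc,
      copowerIns_tensComparison, Category.comp_id]

/-- Equivalences preserve finite-dimensional comodules: with `Φ Z ≅ D`, the coaction of `Φ X`
comes from a morphism `X → Φ X ⊗ Z`, which is a finite sum of morphisms `x ↦ w ⊗ g(x)`. -/
lemma finite_map_obj (X : Comod k C) [Module.Finite k X.carrier] :
    Module.Finite k (Φ.obj X).carrier := by
  let i := Φ.objObjPreimageIso (Comod.regular k D)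
  let W := ModuleCat.of k (Φ.obj X).carrier
  obtain ⟨f, hf⟩ := Φ.map_surjective
    (coactHom (Φ.obj X) ≫ tensR W i.inv ≫ tensComparison Φ W _)
  obtain ⟨n, w, g, rfl⟩ := exists_eq_sum_comp_copowerIns f
  refine finite_of_coactHom_eq_sum _ w (fun j => Φ.map (g j) ≫ i.hom) ?_
  have h : (∑ j, Φ.map (g j) ≫ copowerIns W _ (w j)) ≫ tensComparison Φ W _ =
      (coactHom (Φ.obj X) ≫ tensR W i.inv) ≫ tensComparison Φ W _ := by
    rw [Category.assoc, ← hf, Φ.map_sum, Preadditive.sum_comp]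
    refine Finset.sum_congr rfl fun j _ => ?_
    rw [Category.assoc, copowerIns_tensComparison, ← Φ.map_comp]
  rw [cancel_mono] at h
  have h' := congrArg (· ≫ tensR W i.hom) h
  simp only [Category.assoc, ← Functor.map_comp, i.inv_hom_id, Preadditive.sum_comp] at h'
  rw [CategoryTheory.Functor.map_id, Category.comp_id] at h'
  rw [← h']
  refine Finset.sum_congr rfl fun j _ => ?_
  rw [copowerIns_map_right, Category.assoc]

/-- The value of `Φ` on a finite-dimensional comodule. -/
def mapFd (X : FdComod k C) : FdComod k D := ⟨Φ.obj X.obj, finite_map_obj Φ X.obj⟩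

/-- Equivalences are essentially surjective on finite-dimensional comodules. -/
lemma exists_fdComod_iso (X' : FdComod k D) :
    ∃ X : FdComod k C, Nonempty (Φ.obj X.obj ≅ X'.obj) :=
  have : Φ.asEquivalence.functor.Additive := ‹Φ.Additive›
  have : Φ.asEquivalence.functor.Linear k := ‹Φ.Linear k›
  ⟨mapFd Φ.asEquivalence.inverse X', ⟨Φ.asEquivalence.counitIso.app X'.obj⟩⟩

/-- The isomorphism `Hom^C(X, M) ⊗ Φ Y ≅ Φ (Hom^C(X, M) ⊗ Y)`, with `Hom^C(X, M)` replaced by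
`Hom^D(Φ X, Φ M)` on the left. -/
def homTensIso (X M Y : Comod k C) :
    tens (homSpace (Φ.obj X) (Φ.obj M)) (Φ.obj Y) ≅ Φ.obj (tens (homSpace X M) Y) :=
  ((Comod.copower k D).mapIso (mapHomEquiv Φ X M).symm.toModuleIso).app (Φ.obj Y) ≪≫
    asIso (tensComparison Φ _ Y)

lemma homTensIso_hom (X M Y : Comod k C) : (homTensIso Φ X M Y).hom =
    tensL (mapHomEquiv Φ X M).symm.toModuleIso.hom (Φ.obj Y) ≫ tensComparison Φ _ Y := rfl

lemma homTensIso_naturality_right (X M : Comod k C) {Y Y' : Comod k C} (g : Y ⟶ Y') :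
    tensR _ (Φ.map g) ≫ (homTensIso Φ X M Y').hom =
      (homTensIso Φ X M Y).hom ≫ Φ.map (tensR _ g) := by
  rw [homTensIso_hom, homTensIso_hom, ← Category.assoc, ← tensL_tensR, Category.assoc,
    tensComparison_naturality_right, Category.assoc]

lemma homTensIso_naturality {X X' M M' : Comod k C} (Y : Comod k C)
    (a : homSpace X M ⟶ homSpace X' M')
    (a' : homSpace (Φ.obj X) (Φ.obj M) ⟶ homSpace (Φ.obj X') (Φ.obj M'))
    (h : ∀ l : X ⟶ M, a'.hom (Φ.map l) = Φ.map (a.hom l)) :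
    tensL a' (Φ.obj Y) ≫ (homTensIso Φ X' M' Y).hom =
      (homTensIso Φ X M Y).hom ≫ Φ.map (tensL a Y) := by
  have e : a' ≫ (mapHomEquiv Φ X' M').symm.toModuleIso.hom =
      (mapHomEquiv Φ X M).symm.toModuleIso.hom ≫ a := by
    ext l : 2
    obtain ⟨l, rfl⟩ := (mapHomEquiv Φ X M).surjective l
    change (mapHomEquiv Φ X' M').symm (a'.hom (Φ.map l)) =
      a.hom ((mapHomEquiv Φ X M).symm (mapHomEquiv Φ X M l))
    rw [h, LinearEquiv.symm_apply_apply, LinearEquiv.symm_apply_eq]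
    rfl
  rw [homTensIso_hom, homTensIso_hom, ← Category.assoc, ← tensL_comp, e, tensL_comp,
    Category.assoc, tensComparison_naturality_left, Category.assoc]


/-! ### Invariance of the Nakayama functors -/

section Transport

variable {N : Comod k D} {X' Y' : Comod k D} {X Y : FdComod k C}

/-- The morphism `Hom(X', N) ⊗ X' → Hom(Y', N) ⊗ Y'` given by an isomorphism `X' ≅ Y'`. -/
def transport (N : Comod k D) (c : X' ≅ Y') :
    tens (homSpace X' N) X' ⟶ tens (homSpace Y' N) Y' :=
  tensR _ c.hom ≫ tensL (precomp c.inv N) Y'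

lemma precomp_comp {X Y Z N : Comod k D} (g : X ⟶ Y) (h : Y ⟶ Z) :
    precomp h N ≫ precomp g N = precomp (g ≫ h) N := by
  ext l : 2
  exact (Category.assoc g h l).symm

lemma tensL_precomp_id (X N Y : Comod k D) : tensL (precomp (𝟙 X) N) Y = 𝟙 _ := by
  have : precomp (𝟙 X) N = 𝟙 _ := by
    ext l : 2
    exact Category.id_comp l
  rw [tensL, this, CategoryTheory.Functor.map_id, NatTrans.id_app]

lemma transport_refl (N X' : Comod k D) : transport N (Iso.refl X') = 𝟙 _ := by
  rw [transport, Iso.refl_hom, Iso.refl_inv, tensL_precomp_id, tensR, CategoryTheory.Functor.map_id,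
    Category.comp_id]

lemma nakLProj_transport (N : Comod k D) {X' Y' : FdComod k D} (c : X'.obj ≅ Y'.obj) :
    nakLProj N X'.obj ≫ transport N c = nakLProj N Y'.obj := by
  rw [transport, ← Category.assoc]
  refine (congrArg (· ≫ tensL (precomp c.inv N) Y'.obj)
    (nakLProj_wedge N (ObjectProperty.homMk c.hom : X' ⟶ Y'))).trans ?_
  rw [Category.assoc]
  refine (congrArg (nakLProj N Y'.obj ≫ ·) (tensL_comp _ _ _).symm).trans ?_
  change _ ≫ tensL (precomp c.hom N ≫ precomp c.inv N) _ = _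
  rw [precomp_comp, c.inv_hom_id, tensL_precomp_id, Category.comp_id]

variable {E : Comod k D}
  {q : ∀ X : FdComod k C, E ⟶ tens (homSpace (Φ.obj X.obj) N) (Φ.obj X.obj)}
  (hq : ∀ ⦃X Y : FdComod k C⦄ (g : X ⟶ Y), q X ≫ tensR _ (Φ.map g.hom) =
    q Y ≫ tensL (precomp (Φ.map g.hom) N) (Φ.obj Y.obj))

omit [Φ.Additive] [Functor.Linear k Φ] in
include hq in
/-- A family which is dinatural on the comodules `Φ X` remains dinatural when it is carried along
isomorphisms to other comodules, as `Φ` is full. -/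
lemma transport_wedge (c : Φ.obj X.obj ≅ X') (d : Φ.obj Y.obj ≅ Y') (g : X' ⟶ Y') :
    (q X ≫ transport N c) ≫ tensR _ g = (q Y ≫ transport N d) ≫ tensL (precomp g N) Y' := by
  obtain ⟨h, hh⟩ := Φ.map_surjective (c.hom ≫ g ≫ d.inv)
  have e1 : transport N c ≫ tensR _ g =
      tensR _ (Φ.map h) ≫ tensR _ d.hom ≫ tensL (precomp c.inv N) Y' := by
    rw [transport, Category.assoc, tensL_tensR, ← Category.assoc, ← Category.assoc,
      ← Functor.map_comp, ← Functor.map_comp, hh]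
    simp
  have e2 : transport N d ≫ tensL (precomp g N) Y' =
      tensL (precomp (Φ.map h) N) _ ≫ tensR _ d.hom ≫ tensL (precomp c.inv N) Y' := by
    rw [transport, Category.assoc, ← tensL_comp, precomp_comp, ← Category.assoc, tensL_tensR,
      Category.assoc, ← tensL_comp, precomp_comp, hh, c.inv_hom_id_assoc]
  have e3 : q X ≫ tensR _ (Φ.map h) = q Y ≫ tensL (precomp (Φ.map h) N) (Φ.obj Y.obj) :=
    hq (ObjectProperty.homMk h)
  rw [Category.assoc, Category.assoc, e1, e2, ← Category.assoc, e3, Category.assoc]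

include hq in
/-- The universal property of `nakL` can be tested on the finite-dimensional comodules `Φ X`. -/
lemma exists_nakL_lift_map : ∃ u : E ⟶ (nakL k D).obj N, ∀ X : FdComod k C,
    u ≫ nakLProj N (mapFd Φ X).obj = q X := by
  choose P hP using exists_fdComod_iso Φ
  let c (X' : FdComod k D) : Φ.obj (P X').obj ≅ X'.obj := (hP X').some
  obtain ⟨u, hu⟩ := exists_nakL_lift (fun X' => q (P X') ≫ transport N (c X'))
    fun X' Y' g => transport_wedge Φ hq (c X') (c Y') g.hom
  refine ⟨u, fun X => (hu (mapFd Φ X)).trans ?_⟩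
  have h := transport_wedge Φ hq (c (mapFd Φ X)) (Iso.refl (Φ.obj X.obj)) (𝟙 _)
  rw [transport_refl, Category.comp_id] at h
  refine Eq.trans ?_ (h.trans ?_)
  · exact (((congrArg (_ ≫ ·) (CategoryTheory.Functor.map_id _ _)).trans
      (Category.comp_id _))).symm
  · exact (congrArg (q X ≫ ·) (tensL_precomp_id _ _ _)).trans (Category.comp_id _)

lemma nakL_hom_ext_map {u v : E ⟶ (nakL k D).obj N}
    (h : ∀ X : FdComod k C, u ≫ nakLProj N (mapFd Φ X).obj = v ≫ nakLProj N (mapFd Φ X).obj) :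
    u = v := by
  refine nakL_hom_ext fun X' => ?_
  obtain ⟨X, ⟨c⟩⟩ := exists_fdComod_iso Φ X'
  rw [← nakLProj_transport N (X' := mapFd Φ X) c, ← Category.assoc, h, Category.assoc]

end Transport

section Comparison

variable (M : Comod k C)

instance (X : FdComod k C) : Module.Finite k (Φ.obj X.obj).carrier := finite_map_obj Φ X.obj

/-- The component at `X` of the wedge `Φ (nakL M) → Φ (Hom^C(X, M) ⊗ X) ≅
Hom^D(Φ X, Φ M) ⊗ Φ X`. -/
def mapNakLProj (X : FdComod k C) :
    Φ.obj ((nakL k C).obj M) ⟶ tens (homSpace (Φ.obj X.obj) (Φ.obj M)) (Φ.obj X.obj) :=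
  Φ.map (nakLProj M X.obj) ≫ (homTensIso Φ X.obj M X.obj).inv

lemma mapNakLProj_homTensIso (X : FdComod k C) :
    mapNakLProj Φ M X ≫ (homTensIso Φ X.obj M X.obj).hom = Φ.map (nakLProj M X.obj) := by
  rw [mapNakLProj, Category.assoc, Iso.inv_hom_id, Category.comp_id]

lemma homTensIso_naturality_precomp {X X' : Comod k C} (g : X ⟶ X') (Y : Comod k C) :
    tensL (precomp (Φ.map g) (Φ.obj M)) (Φ.obj Y) ≫ (homTensIso Φ X M Y).hom =
      (homTensIso Φ X' M Y).hom ≫ Φ.map (tensL (precomp g M) Y) :=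
  homTensIso_naturality Φ Y _ _ fun l => (Φ.map_comp g l).symm

lemma mapNakLProj_wedge ⦃X Y : FdComod k C⦄ (g : X ⟶ Y) :
    mapNakLProj Φ M X ≫ tensR _ (Φ.map g.hom) =
      mapNakLProj Φ M Y ≫ tensL (precomp (Φ.map g.hom) (Φ.obj M)) (Φ.obj Y.obj) := by
  rw [← cancel_mono (homTensIso Φ X.obj M Y.obj).hom, Category.assoc, Category.assoc,
    homTensIso_naturality_right, homTensIso_naturality_precomp, ← Category.assoc,
    ← Category.assoc, mapNakLProj_homTensIso, mapNakLProj_homTensIso, ← Φ.map_comp,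
    ← Φ.map_comp]
  exact congrArg Φ.map (nakLProj_wedge M g)

lemma map_nakL_hom_ext {E : Comod k D} {u v : E ⟶ Φ.obj ((nakL k C).obj M)}
    (h : ∀ X : FdComod k C, u ≫ mapNakLProj Φ M X = v ≫ mapNakLProj Φ M X) : u = v := by
  let i := Φ.objObjPreimageIso E
  obtain ⟨u', hu⟩ := Φ.map_surjective (i.hom ≫ u)
  obtain ⟨v', hv⟩ := Φ.map_surjective (i.hom ≫ v)
  rw [← cancel_epi i.hom, ← hu, ← hv]
  refine congrArg Φ.map (nakL_hom_ext fun X => Φ.map_injective ?_)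
  rw [Φ.map_comp, Φ.map_comp, hu, hv, ← mapNakLProj_homTensIso, Category.assoc, Category.assoc,
    ← Category.assoc u, ← Category.assoc v, h]

/-- The universal wedge of `Φ M` factors through the image under `Φ` of the universal wedge of
`M`. -/
lemma exists_map_nakL_lift : ∃ u : (nakL k D).obj (Φ.obj M) ⟶ Φ.obj ((nakL k C).obj M),
    ∀ X : FdComod k C, u ≫ mapNakLProj Φ M X = nakLProj (Φ.obj M) (Φ.obj X.obj) := by
  let i := Φ.objObjPreimageIso ((nakL k D).obj (Φ.obj M))
  choose p hp using fun X : FdComod k C => Φ.map_surjective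
    (i.hom ≫ nakLProj (Φ.obj M) (Φ.obj X.obj) ≫ (homTensIso Φ X.obj M X.obj).hom)
  obtain ⟨v, hv⟩ := exists_nakL_lift p fun X Y g => Φ.map_injective (by
    rw [Φ.map_comp, Φ.map_comp, hp, hp]
    simp only [Category.assoc]
    rw [← homTensIso_naturality_right, ← homTensIso_naturality_precomp]
    have h : nakLProj (Φ.obj M) (Φ.obj X.obj) ≫ tensR _ (Φ.map g.hom) =
        nakLProj (Φ.obj M) (Φ.obj Y.obj) ≫
          tensL (precomp (Φ.map g.hom) (Φ.obj M)) (Φ.obj Y.obj) :=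
      nakLProj_wedge (Φ.obj M) (ObjectProperty.homMk (Φ.map g.hom) : mapFd Φ X ⟶ mapFd Φ Y)
    rw [← Category.assoc (nakLProj _ _), h, Category.assoc])
  refine ⟨i.inv ≫ Φ.map v, fun X => ?_⟩
  rw [← cancel_mono (homTensIso Φ X.obj M X.obj).hom, Category.assoc, mapNakLProj_homTensIso,
    Category.assoc, ← Φ.map_comp, hv, hp, i.inv_hom_id_assoc]

lemma exists_nakL_iso : ∃ e : Φ.obj ((nakL k C).obj M) ≅ (nakL k D).obj (Φ.obj M),
    ∀ X : FdComod k C, e.hom ≫ nakLProj (Φ.obj M) (Φ.obj X.obj) = mapNakLProj Φ M X := by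
  obtain ⟨u, hu⟩ := exists_nakL_lift_map Φ (mapNakLProj_wedge Φ M)
  obtain ⟨v, hv⟩ := exists_map_nakL_lift Φ M
  have hu' (X : FdComod k C) : u ≫ nakLProj (Φ.obj M) (Φ.obj X.obj) = mapNakLProj Φ M X := hu X
  refine ⟨⟨u, v, map_nakL_hom_ext Φ M fun X => ?_, nakL_hom_ext_map Φ fun X => ?_⟩, hu'⟩
  · rw [Category.assoc, hv, hu', Category.id_comp]
  · refine (Category.assoc _ _ _).trans ((congrArg (v ≫ ·) (hu' X)).trans ((hv X).trans ?_))
    exact (Category.id_comp _).symm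

lemma map_nakL_map_mapNakLProj {M M' : Comod k C} (g : M ⟶ M') (X : FdComod k C) :
    Φ.map ((nakL k C).map g) ≫ mapNakLProj Φ M' X =
      mapNakLProj Φ M X ≫ tensL (postcomp (Φ.obj X.obj) (Φ.map g)) (Φ.obj X.obj) := by
  have h := homTensIso_naturality Φ X.obj (postcomp X.obj g)
    (postcomp (Φ.obj X.obj) (Φ.map g)) fun l => (Φ.map_comp l g).symm
  rw [← cancel_mono (homTensIso Φ X.obj M' X.obj).hom, Category.assoc, mapNakLProj_homTensIso,
    Category.assoc, h, ← Category.assoc, mapNakLProj_homTensIso, ← Φ.map_comp, ← Φ.map_comp,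
    nakL_map_nakLProj]

/-- Equivalences of comodule categories commute with the left exact Nakayama functors. -/
lemma nonempty_nakL_iso : Nonempty (nakL k C ⋙ Φ ≅ Φ ⋙ nakL k D) := by
  choose e he using exists_nakL_iso Φ
  refine ⟨NatIso.ofComponents e fun {M M'} g => nakL_hom_ext_map Φ fun X => ?_⟩
  have h1 : (Φ.map ((nakL k C).map g) ≫ (e M').hom) ≫ nakLProj (Φ.obj M') (Φ.obj X.obj) =
      ((e M).hom ≫ (nakL k D).map (Φ.map g)) ≫ nakLProj (Φ.obj M') (Φ.obj X.obj) := by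
    rw [Category.assoc, he, map_nakL_map_mapNakLProj, Category.assoc, nakL_map_nakLProj,
      ← Category.assoc, he]
  exact h1

/-- Equivalences of comodule categories commute with the right exact Nakayama functors, as these
are the left adjoints of the left exact ones. -/
lemma nonempty_nakR_iso : Nonempty (nakR k C ⋙ Φ ≅ Φ ⋙ nakR k D) := by
  let e := Φ.asEquivalence
  have : e.functor.Additive := ‹Φ.Additive›
  have : e.functor.Linear k := ‹Φ.Linear k›
  obtain ⟨i⟩ := nonempty_nakL_iso e.inverse
  exact ⟨((nakAdjunction k C).comp e.toAdjunction).leftAdjointUniq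
    ((e.toAdjunction.comp (nakAdjunction k D)).ofNatIsoRight i)⟩

end Comparison

end Equivalence

end

end Nakayama

theorem mainTheorem1 (k : Type u) [Field k] (C : Type u) [AddCommGroup C] [Module k C]
    [Coalgebra k C] :
    (∀ M : Nakayama.Comod k C,
      Nakayama.IsEnd (Nakayama.integrandL M) ((Nakayama.nakL k C).obj M) ∧
      Nakayama.IsCoend (Nakayama.integrandR M) ((Nakayama.nakR k C).obj M)) ∧
    (∀ (D : Type u) [AddCommGroup D] [Module k D] [Coalgebra k D]
      (Φ : Nakayama.Comod k C ⥤ Nakayama.Comod k D) [Φ.IsEquivalence] [Φ.Additive]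
      [Functor.Linear k Φ],
      Nonempty (Nakayama.nakL k C ⋙ Φ ≅ Φ ⋙ Nakayama.nakL k D) ∧
      Nonempty (Nakayama.nakR k C ⋙ Φ ≅ Φ ⋙ Nakayama.nakR k D)) := by
  refine ⟨fun M => ⟨Nakayama.isEnd_nakL M, Nakayama.isCoend_nakR M⟩, ?_⟩
  intro D _ _ _ Φ _ _ _
  exact ⟨Nakayama.nonempty_nakL_iso Φ, Nakayama.nonempty_nakR_iso Φ⟩
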